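/- For $M\in\mathbb R^{n\times n}$ and $\alpha\subseteq[n]=\{1,\dots,n\}$ let $M_\alpha$ be the principal submatrix with rows and columns in $\alpha$ (with $\det M_\varnothing=1$), and let $C(\alpha,M)$ be the $n\times n$ matrix whose $j$-th column is $-M_{\bullet j}$ if $j\in\alpha$ and the unit vector $e_j$ if $j\notin\alpha$. If $C(\alpha,M)$ is invertible and $q\in\mathbb R^n$, let $\mathrm{out}_q(\alpha,M)\in\mathbb F_2^n$ have $i$-th coordinate $1$ if $(C(\alpha,M)^{-1}q)_i>0$ and $0$ otherwise. Let $\chi(\alpha)\in\mathbb F_2^n$ be the characteristic vector of $\alpha$. Call $q$ nondegenerate for $M$ if $(C(\gamma,M)^{-1}q)_i\ne0$ for all $i$ and all $\gamma\subseteq[n]$ with $C(\gamma,M)$ invertible. A violation of type (PV1) for $M$ is a set $\alpha\subseteq[n]$ with $\det M_\alpha\le0$. A violation of type (PV3) (a failed unique sink orientation) is either a set $\gamma\subseteq[n]$ with $C(\gamma,M)$ not invertible, or a vector $q$ and two distinct sets $\alpha,\beta\subseteq[n]$ with $C(\alpha,M)$, $C(\beta,M)$ invertible and $$[\chi(\alpha)\oplus\chi(\beta)]\cap[\mathrm{out}_q(\alpha,M)\oplus\mathrm{out}_q(\beta,M)]=0^n,$$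 where $\oplus$ is addition and $\cap$ the coordinatewise product in $\mathbb F_2^n$. **Theorem.** A violation of type (PV1) can be converted to a violation of type (PV3) in polynomial time. In detail: 1. Let $M\in\mathbb R^{n\times n}$ and $\det M_{\alpha_0}\le0$. Then there is $\alpha\subseteq\alpha_0$ such that either $\det M_\alpha=0$ and $C(\alpha,M)$ is not invertible, or $\det M_\alpha<0<\det M_{\alpha\setminus\{i\}}$ for some $i\in\alpha$. 2. Let $M\in\mathbb R^{n\times n}$, $i\in\alpha\subseteq[n]$, $\beta=\alpha\setminus\{i\}$ and $\det M_\alpha<0<\det M_\beta$. Then for every $q\in\mathbb R^n$ that is nondegenerate for $M$, $\mathrm{out}_q(\alpha,M)_i=\mathrm{out}_q(\beta,M)_i$, and $q,\alpha,\beta$ form a violation of type (PV3). 3. Let $M\in\mathbb Q^{n\times n}$ and let $\sigma(M)$ be the number of bits of $M$, where each entry takes a sign bit and the binary digits of its numerator and its denominator in lowest terms. For every integer $\sigma\ge\sigma(M)$ the vector $q$ with $q_i=2^{-4i\sigma}$, $i=1,\dots,n$, is nondegenerate for $M$. 4. There is an algorithm which, given $n$, a matrix $M\in\mathbb Q^{n\times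 n}$ and a set $\alpha_0\subseteq[n]$ with $\det M_{\alpha_0}\le0$, outputs a violation of type (PV3) for $M$ in time polynomial in the bit length of the input (on a random access machine with logarithmic cost). The output is either a set $\gamma\subseteq\alpha_0$ with $\det M_\gamma=0$, or $q,\alpha,\beta$ with $\alpha\subseteq\alpha_0$, $\beta=\alpha\setminus\{i\}$ for some $i\in\alpha$, $\det M_\alpha<0<\det M_\beta$, and $q_i=2^{-4i\sigma(M)}$, a vector that is nondegenerate for $M$. -/

import Mathlib

namespace PMatrixUSO

/-! ### Principal minors, complementary cones, outmaps -/

section Witnesses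

variable {K : Type*} [Field K] [LinearOrder K] {n : ℕ}

/-- The principal minor `det (M_α)`; it is `1` for `α = ∅`. -/
def principalMinor (M : Matrix (Fin n) (Fin n) K) (α : Finset (Fin n)) : K :=
  (M.submatrix (fun i : {i // i ∈ α} => (i : Fin n)) (fun j : {j // j ∈ α} => (j : Fin n))).det

/-- The matrix `C(α, M)`: column `j` is `-M_{• j}` if `j ∈ α` and the unit vector `e_j`
otherwise. -/
def cone (M : Matrix (Fin n) (Fin n) K) (α : Finset (Fin n)) : Matrix (Fin n) (Fin n) K :=
  Matrix.of fun i j => if j ∈ α then -M i j else if i = j then 1 else 0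

/-- The characteristic vector of a set, in `𝔽₂ⁿ`. -/
def char (α : Finset (Fin n)) : Fin n → ZMod 2 := fun i => if i ∈ α then 1 else 0

/-- The outmap of `α` with respect to `q`, a vector in `𝔽₂ⁿ`. It is meaningful only if
`cone M α` is invertible, and is used only together with that condition. -/
noncomputable def outmap (M : Matrix (Fin n) (Fin n) K) (q : Fin n → K) (α : Finset (Fin n)) :
    Fin n → ZMod 2 :=
  fun i => if 0 < ((cone M α)⁻¹.mulVec q) i then 1 else 0

/-- `q` is nondegenerate for `M`: no coordinate of `C(γ, M)⁻¹ q` vanishes, for all `γ` for which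
the inverse exists (so for all `γ` if all principal minors of `M` are nonzero). -/
def Nondegenerate (M : Matrix (Fin n) (Fin n) K) (q : Fin n → K) : Prop :=
  ∀ γ : Finset (Fin n), IsUnit (cone M γ) → ∀ i, ((cone M γ)⁻¹.mulVec q) i ≠ 0

/-- `q, α, β` witness a failed unique sink orientation: `α ≠ β`, both outmaps are defined, and
`(char α ⊕ char β) ∩ (outmap α ⊕ outmap β) = 0ⁿ`; here `⊕` is addition in `𝔽₂ⁿ` and `∩` the
coordinatewise product. -/
def FailedUSO (M : Matrix (Fin n) (Fin n) K) (q : Fin n → K) (α β : Finset (Fin n)) : Prop :=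
  α ≠ β ∧ IsUnit (cone M α) ∧ IsUnit (cone M β) ∧
    (char α + char β) * (outmap M q α + outmap M q β) = 0

end Witnesses

/-- The data of a violation of the unique sink orientation property: a single set, or a rational
vector with two sets. -/
inductive USOWitness (n : ℕ) : Type
  | singular (γ : Finset (Fin n)) : USOWitness n
  | pair (q : Fin n → ℚ) (α β : Finset (Fin n)) : USOWitness n

/-- The data form a violation for `M`: the set has a singular `C(γ, M)`, or the vector and the two
sets witness a failed unique sink orientation. -/
def USOWitness.IsViolation {n : ℕ} (M : Matrix (Fin n) (Fin n) ℚ) : USOWitness n → Prop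
  | .singular γ => ¬ IsUnit (cone M γ)
  | .pair q α β => FailedUSO M q α β

/-- The number of bits of a rational matrix: each entry takes a sign bit and the binary digits of
its numerator and its denominator (in lowest terms). -/
def matrixBits {n : ℕ} (M : Matrix (Fin n) (Fin n) ℚ) : ℕ :=
  ∑ i, ∑ j, (1 + Nat.size (M i j).num.natAbs + Nat.size (M i j).den)

/-- The vector with entries `2 ^ (-4 i σ)`, `i = 1, …, n` (`Fin n` counts from `0`). -/
def powerVector (n σ : ℕ) : Fin n → ℚ := fun i => ((2 : ℚ) ^ (4 * ((i : ℕ) + 1) * σ))⁻¹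

/-! ### Random access machines with logarithmic cost

Structured programs over finitely many integer arrays of unbounded length. Every value that occurs
in an execution is charged its bit length, so that running times are polynomially related to those
of Turing machines. -/

/-- The memory: `m k j` is entry `j` of array `k`. -/
abbrev Mem : Type := ℕ → ℕ → ℤ

/-- Integer expressions; `get k e` is indirect access to array `k` at the index given by `e`. -/
inductive Expr : Type
  | lit (z : ℤ) : Expr
  | get (k : ℕ) (e : Expr) : Expr
  | add (e f : Expr) : Expr
  | sub (e f : Expr) : Expr
  | mul (e f : Expr) : Expr
  | div (e f : Expr) : Expr

/-- The value of an expression. Division is integer division, with value `0` for divisor `0`;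
negative indices are read as `0`. -/
def Expr.eval (m : Mem) : Expr → ℤ
  | .lit z => z
  | .get k e => m k (e.eval m).toNat
  | .add e f => e.eval m + f.eval m
  | .sub e f => e.eval m - f.eval m
  | .mul e f => e.eval m * f.eval m
  | .div e f => e.eval m / f.eval m

/-- The bit length of an integer, with a sign bit. -/
def bits (z : ℤ) : ℕ := Nat.size z.natAbs + 1

/-- The cost of evaluating an expression: the total bit length of the values of all its
subexpressions. -/
def Expr.cost (m : Mem) : Expr → ℕ
  | .lit z => bits z
  | .get k e => e.cost m + bits ((Expr.get k e).eval m)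
  | .add e f => e.cost m + f.cost m + bits ((Expr.add e f).eval m)
  | .sub e f => e.cost m + f.cost m + bits ((Expr.sub e f).eval m)
  | .mul e f => e.cost m + f.cost m + bits ((Expr.mul e f).eval m)
  | .div e f => e.cost m + f.cost m + bits ((Expr.div e f).eval m)

/-- Programs. `set k e f` stores the value of `f` in array `k` at index `e`. Tests ask whether the
value of an expression is positive. -/
inductive Prog : Type
  | skip : Prog
  | set (k : ℕ) (e f : Expr) : Prog
  | seq (c d : Prog) : Prog
  | ite (e : Expr) (c d : Prog) : Prog
  | loop (e : Expr) (c : Prog) : Prog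

/-- `Run c m m' t`: started in memory `m`, the program `c` halts in memory `m'` at total
cost `t`. -/
inductive Run : Prog → Mem → Mem → ℕ → Prop
  | skip (m : Mem) : Run .skip m m 1
  | set (k : ℕ) (e f : Expr) (m : Mem) :
      Run (.set k e f) m
        (Function.update m k (Function.update (m k) (e.eval m).toNat (f.eval m)))
        (e.cost m + f.cost m + 1)
  | seq {c d : Prog} {m₀ m₁ m₂ : Mem} {t u : ℕ} :
      Run c m₀ m₁ t → Run d m₁ m₂ u → Run (.seq c d) m₀ m₂ (t + u + 1)
  | ite_pos {e : Expr} {c d : Prog} {m m' : Mem} {t : ℕ} :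
      0 < e.eval m → Run c m m' t → Run (.ite e c d) m m' (e.cost m + t + 1)
  | ite_neg {e : Expr} {c d : Prog} {m m' : Mem} {t : ℕ} :
      ¬ 0 < e.eval m → Run d m m' t → Run (.ite e c d) m m' (e.cost m + t + 1)
  | loop_stop {e : Expr} {c : Prog} {m : Mem} :
      ¬ 0 < e.eval m → Run (.loop e c) m m (e.cost m + 1)
  | loop_step {e : Expr} {c : Prog} {m₀ m₁ m₂ : Mem} {t u : ℕ} :
      0 < e.eval m₀ → Run c m₀ m₁ t → Run (.loop e c) m₁ m₂ u →
        Run (.loop e c) m₀ m₂ (e.cost m₀ + t + u + 1)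

/-- The initial memory for an input: array `k` holds the `k`-th list, and every other entry
is `0`. -/
def Mem.load (x : List (List ℤ)) : Mem := fun k j => (x.getD k []).getD j 0

/-- The memory holds an output: for each `k`, array `k` starts with the `k`-th list. -/
def Mem.Holds (m : Mem) (y : List (List ℤ)) : Prop :=
  ∀ k < y.length, ∀ j < (y.getD k []).length, m k j = (y.getD k []).getD j 0

/-- The bit length of an input. -/
def inputBits (x : List (List ℤ)) : ℕ := (x.map fun l => (l.map bits).sum).sum

/-- A search problem is solvable in polynomial time: one program, on every input `x` that keeps the
promise `P`, halts within a number of steps polynomial in the bit length of `x`, and outputs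
some `y` that is related to `x` by `R`. -/
def SolvableInPolyTime {X : Type} {Y : X → Type} (encX : X → List (List ℤ))
    (encY : ∀ x, Y x → List (List ℤ)) (P : X → Prop) (R : ∀ x, Y x → Prop) : Prop :=
  ∃ (c : Prog) (p : Polynomial ℕ), ∀ x, P x →
    ∃ (y : Y x) (m : Mem) (t : ℕ),
      Run c (Mem.load (encX x)) m t ∧ t ≤ p.eval (inputBits (encX x)) ∧
        Mem.Holds m (encY x y) ∧ R x y

/-! ### The search problem and its encodings -/

/-- A rational matrix with a set of indices. -/
structure MinorInstance : Type where
  n : ℕ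
  M : Matrix (Fin n) (Fin n) ℚ
  α : Finset (Fin n)

/-- The `0/1` list of a set. -/
def encodeSet {n : ℕ} (α : Finset (Fin n)) : List ℤ :=
  List.ofFn fun i : Fin n => if i ∈ α then 1 else 0

/-- The dimension, the numerators and the denominators of the entries in row-major order, and the
set. -/
def MinorInstance.encode (x : MinorInstance) : List (List ℤ) :=
  [[(x.n : ℤ)],
   List.ofFn fun k : Fin (x.n * x.n) => (x.M k.divNat k.modNat).num,
   List.ofFn fun k : Fin (x.n * x.n) => ((x.M k.divNat k.modNat).den : ℤ),
   encodeSet x.α]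

/-- A tag, followed by the sets and by the numerators and denominators of the vector. -/
def USOWitness.encode {n : ℕ} : USOWitness n → List (List ℤ)
  | .singular γ => [[0], encodeSet γ]
  | .pair q α β =>
      [[1], encodeSet α, encodeSet β, List.ofFn fun i => (q i).num,
       List.ofFn fun i => ((q i).den : ℤ)]

/-- What the witness computed from a matrix `M` and a set `α₀` has to be, besides a violation:
a subset of `α₀` with vanishing principal minor, or `α ⊆ α₀` and `β = α - i` whose principal minors
are negative and positive, with the nondegenerate vector `q_i = 2 ^ (-4 i σ)`, where `σ` is the
number of bits of `M`. -/
def USOWitness.Prescribed {n : ℕ} (M : Matrix (Fin n) (Fin n) ℚ) (α₀ : Finset (Fin n)) :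
    USOWitness n → Prop
  | .singular γ => γ ⊆ α₀ ∧ principalMinor M γ = 0
  | .pair q α β =>
      α ⊆ α₀ ∧ (∃ i ∈ α, β = α.erase i) ∧ principalMinor M α < 0 ∧ 0 < principalMinor M β ∧
        q = powerVector n (matrixBits M) ∧ Nondegenerate M q

end PMatrixUSO

open PMatrixUSO

namespace PMatrixUSO

/-! ### Determinants of the matrices C(α, M), sign changes and outmaps. -/

section Cone

variable {K : Type*} [Field K] {n : ℕ}

/-! The empty minor is `1`, so on a chain of sets growing by one element from `∅` to a set with
nonpositive minor, some first minor is nonpositive. Either it vanishes, or it is negative and its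
predecessor on the chain is positive. In the second case let β = α∖{i}. The matrices C(α, M) and
C(β, M) differ only in column i, so Cramer's rule gives the i-th coordinates of C(α, M)⁻¹q and C(β,
M)⁻¹q the same numerator. Their denominators are (-1)^|α| det M_α and (-1)^|β| det M_β, which have
the same sign. Hence the outmaps agree at i, the only coordinate at which the characteristic vectors
differ (`failedUSO_erase`).

For nondegeneracy, a vanishing coordinate of C(γ, M)⁻¹q is a relation between the powers of 2^(4σ).
Its coefficients are entries of an adjugate row, made integral by the product D of all denominators
and too small for cancellation (`exists_int_abs_le_two_pow`, `digits_eq_zero`). So the whole row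
vanishes, against invertibility.

The algorithm tests the chain of prefixes `below α k`, by fraction-free elimination on the integer
matrix D • M. Every number that arises is a minor bordering the current prefix, hence of polynomial
length, and the pivot is the next minor on the chain (`blockMinor_mul_borderedMinor_insert`,
`Achieves.elimProg`). Time is bounded by a total-correctness calculus: with all memory entries below
2^L, a program costs at most its weight times a number of passes times L + 1. -/

theorem det_cone (M : Matrix (Fin n) (Fin n) K) (α : Finset (Fin n)) :
    (cone M α).det = (-1) ^ α.card * principalMinor M α := by
  rw [Matrix.twoBlockTriangular_det' (cone M α) (· ∈ α)]
  · have h1 : (cone M α).toSquareBlockProp (· ∈ α) =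
        -(M.submatrix (fun i : {i // i ∈ α} => (i : Fin n))
          (fun j : {j // j ∈ α} => (j : Fin n))) := by
      ext i j
      simp [cone, Matrix.toSquareBlockProp, j.2]
    have h2 : (cone M α).toSquareBlockProp (fun i => ¬ i ∈ α) = 1 := by
      ext i j
      simp [cone, Matrix.toSquareBlockProp, j.2, Matrix.one_apply, Subtype.ext_iff]
    rw [h1, h2, Matrix.det_one, mul_one, principalMinor]
    convert Matrix.det_neg _ using 2
    · simp
    · congr!
  · intro i hi j hj
    have : i ≠ j := fun h => hj (h ▸ hi)
    simp [cone, hj, this]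

theorem isUnit_cone_iff (M : Matrix (Fin n) (Fin n) K) (α : Finset (Fin n)) :
    IsUnit (cone M α) ↔ principalMinor M α ≠ 0 := by
  rw [Matrix.isUnit_iff_isUnit_det, det_cone, isUnit_iff_ne_zero]
  simp

theorem principalMinor_empty (M : Matrix (Fin n) (Fin n) K) : principalMinor M ∅ = 1 := by
  simp [principalMinor]

/-- Removing elements one at a time must lead to a positive minor, at `∅` at the latest, unless a
zero minor is met before. -/
theorem exists_singular_or_sign_change [LinearOrder K] [IsStrictOrderedRing K] (M : Matrix (Fin n) (Fin n) K)
    (α₀ : Finset (Fin n)) (h : principalMinor M α₀ ≤ 0) :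
    ∃ α ⊆ α₀, (principalMinor M α = 0 ∧ ¬ IsUnit (cone M α)) ∨
      ∃ i ∈ α, principalMinor M α < 0 ∧ 0 < principalMinor M (α.erase i) := by
  induction α₀ using Finset.strongInduction with
  | H α ih =>
    rcases h.eq_or_lt with h0 | hneg
    · exact ⟨α, subset_rfl, Or.inl ⟨h0, by simp [isUnit_cone_iff, h0]⟩⟩
    · obtain ⟨i, hi⟩ : α.Nonempty := by
        rw [Finset.nonempty_iff_ne_empty]
        rintro rfl
        rw [principalMinor_empty] at hneg
        exact absurd hneg (not_lt.mpr zero_le_one)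
      rcases le_or_gt (principalMinor M (α.erase i)) 0 with hle | hpos
      · obtain ⟨β, hβ, hr⟩ := ih _ (Finset.erase_ssubset hi) hle
        exact ⟨β, hβ.trans (Finset.erase_subset _ _), hr⟩
      · exact ⟨α, subset_rfl, Or.inr ⟨i, hi, hneg, hpos⟩⟩

/-- Cramer's rule; the second factor does not depend on column `i` of the cone. -/
theorem inv_cone_mulVec (M : Matrix (Fin n) (Fin n) K) (α : Finset (Fin n)) (q : Fin n → K)
    (i : Fin n) : ((cone M α)⁻¹.mulVec q) i =
      (cone M α).det⁻¹ * ((cone M α).updateCol i q).det := by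
  rw [Matrix.inv_def, Matrix.smul_mulVec, ← Matrix.cramer_eq_adjugate_mulVec, Pi.smul_apply,
    Matrix.cramer_apply, smul_eq_mul, Ring.inverse_eq_inv']

theorem updateCol_cone_erase (M : Matrix (Fin n) (Fin n) K) (α : Finset (Fin n)) (q : Fin n → K)
    (i : Fin n) : (cone M (α.erase i)).updateCol i q = (cone M α).updateCol i q := by
  ext r c
  by_cases hc : c = i
  · simp [hc]
  · simp [hc, cone]

theorem outmap_eq_outmap_erase [LinearOrder K] [IsStrictOrderedRing K] (M : Matrix (Fin n) (Fin n) K)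
    (α : Finset (Fin n)) {i : Fin n} (hi : i ∈ α) (hα : principalMinor M α < 0)
    (hβ : 0 < principalMinor M (α.erase i)) (q : Fin n → K) :
    outmap M q α i = outmap M q (α.erase i) i := by
  -- This is the ratio of the two coordinates. The factor -1 from the additional column of `α`
  -- cancels the opposite signs of the minors.
  have key : 0 < (cone M α).det⁻¹ * (cone M (α.erase i)).det := by
    have hε : ((-1 : K) ^ (α.erase i).card)⁻¹ * (-1) ^ (α.erase i).card = 1 :=
      inv_mul_cancel₀ (pow_ne_zero _ (by simp))
    have : (cone M α).det⁻¹ * (cone M (α.erase i)).det =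
        (((-1 : K) ^ (α.erase i).card)⁻¹ * (-1) ^ (α.erase i).card) *
          (-(principalMinor M α)⁻¹ * principalMinor M (α.erase i)) := by
      rw [det_cone, det_cone, ← Finset.card_erase_add_one hi, pow_succ, mul_inv, mul_inv, inv_neg,
        inv_one]
      ring
    rw [this, hε, one_mul]
    exact mul_pos (neg_pos.2 (inv_lt_zero.2 hα)) hβ
  have hβ' : (cone M (α.erase i)).det ≠ 0 := right_ne_zero_of_mul key.ne'
  have : ((cone M α)⁻¹.mulVec q) i = ((cone M α).det⁻¹ * (cone M (α.erase i)).det) *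
      ((cone M (α.erase i))⁻¹.mulVec q) i := by
    rw [inv_cone_mulVec, inv_cone_mulVec, updateCol_cone_erase]
    field_simp
  simp only [outmap, this, mul_pos_iff_of_pos_left key]

theorem failedUSO_erase [LinearOrder K] [IsStrictOrderedRing K] (M : Matrix (Fin n) (Fin n) K)
    (α : Finset (Fin n)) {i : Fin n} (hi : i ∈ α) (hα : principalMinor M α < 0)
    (hβ : 0 < principalMinor M (α.erase i)) (q : Fin n → K) :
    FailedUSO M q α (α.erase i) := by
  refine ⟨fun h => Finset.notMem_erase i α (h ▸ hi), (isUnit_cone_iff _ _).2 hα.ne,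
    (isUnit_cone_iff _ _).2 hβ.ne', ?_⟩
  funext j
  by_cases hj : j = i
  · subst hj
    simp [outmap_eq_outmap_erase M α hi hα hβ q, CharTwo.add_self_eq_zero]
  · simp [char, hj, CharTwo.add_self_eq_zero]

end Cone

/-! ### Determinant bounds and the nondegenerate vector. -/

section Nondegenerate

/-- Modulo `N` the lowest digit vanishes, so it is `0` by its size; divide by `N` and repeat. -/
theorem digits_eq_zero {n : ℕ} (N : ℤ) (C : Fin n → ℤ) (hC : ∀ j, |C j| < N)
    (h : ∑ j, C j * N ^ (j : ℕ) = 0) (j : Fin n) : C j = 0 := by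
  induction n with
  | zero => exact j.elim0
  | succ n ih =>
    have hN : N ≠ 0 := by have := (abs_nonneg _).trans_lt (hC 0); omega
    rw [Fin.sum_univ_succ] at h
    simp only [Fin.val_zero, pow_zero, mul_one, Fin.val_succ, pow_succ, ← mul_assoc,
      ← Finset.sum_mul] at h
    have h0 : C 0 = 0 := Int.eq_zero_of_abs_lt_dvd
      ⟨-(∑ i : Fin n, C i.succ * N ^ (i : ℕ)), by linarith⟩ (hC 0)
    rw [h0, zero_add, mul_eq_zero, or_iff_left hN] at h
    refine Fin.cases h0 (fun i => ?_) j
    exact ih (fun i => C i.succ) (fun i => hC _) h i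

/-- The product expands into a sum over all maps `Fin n → Fin n`; the permutations among them give
the Leibniz terms, and the rest is nonnegative. -/
theorem abs_det_le_prod_sum {n : ℕ} (B : Matrix (Fin n) (Fin n) ℚ) :
    |B.det| ≤ ∏ k, ∑ r, |B r k| := by
  rw [Matrix.det_apply, Finset.prod_univ_sum]
  refine (Finset.abs_sum_le_sum_abs _ _).trans ?_
  have : ∀ σ : Equiv.Perm (Fin n), |Equiv.Perm.sign σ • ∏ i, B (σ i) i| = ∏ i, |B (σ i) i| := by
    intro σ
    rw [← Finset.abs_prod]
    rcases Int.units_eq_one_or (Equiv.Perm.sign σ) with h | h <;> simp [h]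
  simp_rw [this]
  rw [← Finset.sum_image (f := fun f : Fin n → Fin n => ∏ i, |B (f i) i|)
    (g := fun σ : Equiv.Perm (Fin n) => (σ : Fin n → Fin n))
    (fun _ _ _ _ h => DFunLike.coe_injective h)]
  exact Finset.sum_le_sum_of_subset_of_nonneg (fun f _ => by simp)
    (fun _ _ _ => Finset.prod_nonneg fun _ _ => abs_nonneg _)

/-- The summand `1` makes one product bound both a column of `M` and a unit column. -/
theorem one_add_sum_abs_le_prod {n : ℕ} (x : Fin n → ℚ) (s : Finset (Fin n)) :
    1 + ∑ r ∈ s, |x r| ≤ ∏ r ∈ s, (1 + |x r|) := by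
  induction s using Finset.induction_on with
  | empty => simp
  | insert a s ha ih =>
    rw [Finset.sum_insert ha, Finset.prod_insert ha]
    have : 0 ≤ ∑ r ∈ s, |x r| := Finset.sum_nonneg fun _ _ => abs_nonneg _
    nlinarith [abs_nonneg (x a)]

theorem exists_int_prod_den_mul {n : ℕ} (x : Fin n → ℚ) (r : Fin n) :
    ∃ z : ℤ, (∏ s, ((x s).den : ℚ)) * x r = z := by
  refine ⟨(∏ s ∈ Finset.univ.erase r, ((x s).den : ℤ)) * (x r).num, ?_⟩
  rw [← Finset.prod_erase_mul _ _ (Finset.mem_univ r), mul_assoc, Rat.den_mul_eq_num]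
  push_cast
  rfl

theorem exists_int_prod_mul_det {n : ℕ} (B : Matrix (Fin n) (Fin n) ℚ) (d : Fin n → ℚ)
    (h : ∀ r k, ∃ z : ℤ, d k * B r k = z) : ∃ z : ℤ, (∏ k, d k) * B.det = z := by
  choose z hz using h
  refine ⟨(Matrix.of z).det, ?_⟩
  rw [← Matrix.det_mul_row]
  refine Eq.trans ?_ (RingHom.map_det (Int.castRingHom ℚ) _).symm
  congr 1
  ext r k
  simp [hz]

/-- The left side is denominator plus absolute numerator; the sign bit pays for the addition. -/
theorem den_mul_one_add_abs_le (x : ℚ) :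
    (x.den : ℚ) * (1 + |x|) ≤ 2 ^ (1 + Nat.size x.num.natAbs + Nat.size x.den) := by
  have h : (x.den : ℚ) * (1 + |x|) = (x.den + x.num.natAbs : ℕ) := by
    have hd : (0 : ℚ) ≤ x.den := Nat.cast_nonneg _
    rw [mul_add, mul_one, ← abs_of_nonneg hd, ← abs_mul, Rat.den_mul_eq_num, abs_of_nonneg hd]
    push_cast [Nat.cast_natAbs]
    rfl
  rw [h]
  have h1 := Nat.lt_size_self x.den
  have h2 := Nat.lt_size_self x.num.natAbs
  have h3 : 2 ^ x.den.size ≤ 2 ^ (x.num.natAbs.size + x.den.size) :=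
    Nat.pow_le_pow_right two_pos (by omega)
  have h4 : 2 ^ x.num.natAbs.size ≤ 2 ^ (x.num.natAbs.size + x.den.size) :=
    Nat.pow_le_pow_right two_pos (by omega)
  have h5 : x.den + x.num.natAbs ≤ 2 ^ (1 + Nat.size x.num.natAbs + Nat.size x.den) := by
    rw [add_assoc, pow_add, pow_one]
    omega
  exact_mod_cast h5

/-- A bound for the determinant of a matrix each of whose columns is a unit vector or the negative of
a column of `M`. -/
theorem exists_int_abs_le_two_pow {n : ℕ} (M B : Matrix (Fin n) (Fin n) ℚ)
    (hB : ∀ k, (∀ r, B r k = -M r k) ∨ ∃ j, ∀ r, B r k = if r = j then 1 else 0) :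
    ∃ z : ℤ, (∏ k, ∏ r, ((M r k).den : ℚ)) * B.det = z ∧ |z| ≤ 2 ^ matrixBits M := by
  -- Unit columns are scaled as well, so that the total factor does not depend on `B`.
  obtain ⟨z, hz⟩ := exists_int_prod_mul_det B (fun k => ∏ r, ((M r k).den : ℚ)) (fun r k => by
    rcases hB k with h | ⟨j, h⟩
    · obtain ⟨z, hz⟩ := exists_int_prod_den_mul (fun r => M r k) r
      exact ⟨-z, by rw [h]; push_cast; rw [← hz]; ring⟩
    · refine ⟨if r = j then ∏ r, ((M r k).den : ℤ) else 0, ?_⟩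
      rw [h]
      split_ifs <;> simp)
  refine ⟨z, hz, ?_⟩
  have hcol : ∀ k, ∑ r, |B r k| ≤ ∏ r, (1 + |M r k|) := by
    intro k
    have h1 := one_add_sum_abs_le_prod (fun r => M r k) Finset.univ
    have h0 : 0 ≤ ∑ r, |M r k| := Finset.sum_nonneg fun _ _ => abs_nonneg _
    rcases hB k with h | ⟨j, h⟩
    · simp only [h, abs_neg]
      linarith
    · have : ∑ r, |B r k| = 1 := by simp [h, apply_ite abs]
      linarith
  have hD : (0 : ℚ) ≤ ∏ k, ∏ r, ((M r k).den : ℚ) :=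
    Finset.prod_nonneg fun _ _ => Finset.prod_nonneg fun _ _ => Nat.cast_nonneg _
  have : |(z : ℚ)| ≤ 2 ^ matrixBits M := by
    rw [← hz, abs_mul, abs_of_nonneg hD]
    calc _ ≤ (∏ k, ∏ r, ((M r k).den : ℚ)) * ∏ k, ∏ r, (1 + |M r k|) := by
          gcongr
          exact (abs_det_le_prod_sum B).trans (Finset.prod_le_prod
            (fun _ _ => Finset.sum_nonneg fun _ _ => abs_nonneg _) (fun k _ => hcol k))
      _ = ∏ k, ∏ r, ((M r k).den : ℚ) * (1 + |M r k|) := by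
          simp_rw [← Finset.prod_mul_distrib]
      _ = ∏ r, ∏ k, ((M r k).den : ℚ) * (1 + |M r k|) := Finset.prod_comm
      _ ≤ ∏ r, ∏ k, 2 ^ (1 + Nat.size (M r k).num.natAbs + Nat.size (M r k).den) := by
          gcongr
          exact den_mul_one_add_abs_le _
      _ = 2 ^ matrixBits M := by
          simp_rw [matrixBits, ← Finset.prod_pow_eq_pow_sum]
  exact_mod_cast this

theorem matrixBits_pos {n : ℕ} (M : Matrix (Fin n) (Fin n) ℚ) (hn : 0 < n) : 0 < matrixBits M := by
  refine Finset.sum_pos (fun i _ => Finset.sum_pos (fun j _ => by omega) ?_) ?_ <;>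
  exact ⟨⟨0, hn⟩, Finset.mem_univ _⟩

theorem nondegenerate_powerVector {n : ℕ} (M : Matrix (Fin n) (Fin n) ℚ) (σ : ℕ)
    (hσ : matrixBits M ≤ σ) : Nondegenerate M (powerVector n σ) := by
  intro γ hγ i hzero
  -- Positivity makes the digit bound 2^σ(M) strictly smaller than the base 2^(4σ).
  have hσ0 : 0 < σ := (matrixBits_pos M i.pos).trans_le hσ
  set A := cone M γ with hA
  have hdet : IsUnit A.det := (Matrix.isUnit_iff_isUnit_det _).1 hγ
  set D : ℚ := ∏ k, ∏ r, ((M r k).den : ℚ) with hDdef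
  have hD : D ≠ 0 := Finset.prod_ne_zero_iff.2 fun _ _ => Finset.prod_ne_zero_iff.2 fun _ _ => by
    exact_mod_cast Rat.den_nz _
  have hadj : ∀ j, ∃ z : ℤ, D * A.adjugate i j = z ∧ |z| ≤ 2 ^ matrixBits M := by
    intro j
    have : A.adjugate i j = (A.updateCol i (Pi.single j 1)).det := by
      rw [← Matrix.cramer_apply, Matrix.cramer_eq_adjugate_mulVec, Matrix.mulVec_single_one]
      rfl
    rw [this]
    refine exists_int_abs_le_two_pow M _ fun k => ?_
    by_cases hk : k = i
    · exact Or.inr ⟨j, fun r => by simp [hk, Pi.single_apply]⟩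
    · by_cases hkγ : k ∈ γ
      · exact Or.inl fun r => by simp [hk, hA, cone, hkγ]
      · exact Or.inr ⟨k, fun r => by simp [hk, hA, cone, hkγ]⟩
  choose C hC hCle using hadj
  have hN : (2 : ℤ) ^ matrixBits M < 2 ^ (4 * σ) := pow_lt_pow_right₀ one_lt_two (by omega)
  -- Multiplication by D · 2^(4σn) turns the relation into an expansion in base 2^(4σ), with the
  -- digits in reverse order.
  have hsum : ∑ j, C j * ((2 : ℤ) ^ (4 * σ)) ^ (n - (j + 1) : ℕ) = 0 := by
    have h1 : ∑ j, A.adjugate i j * powerVector n σ j = 0 := by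
      rw [Matrix.inv_def, Matrix.smul_mulVec, Pi.smul_apply, smul_eq_mul, mul_eq_zero,
        Ring.inverse_eq_inv', inv_eq_zero, or_iff_right hdet.ne_zero] at hzero
      exact hzero
    have h2 : ((∑ j, C j * ((2 : ℤ) ^ (4 * σ)) ^ (n - (j + 1) : ℕ) : ℤ) : ℚ) =
        D * 2 ^ (4 * σ * n) * ∑ j, A.adjugate i j * powerVector n σ j := by
      push_cast
      rw [Finset.mul_sum]
      refine Finset.sum_congr rfl fun j _ => ?_
      rw [← hC, powerVector]
      have : 4 * σ * n = 4 * σ * (n - (j + 1)) + 4 * ((j : ℕ) + 1) * σ := by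
        obtain ⟨c, hc⟩ := Nat.exists_eq_add_of_le (Nat.succ_le_of_lt j.2)
        rw [show n - ((j : ℕ) + 1) = c by omega]
        refine (congrArg (4 * σ * ·) hc).trans ?_
        simp only [Nat.succ_eq_add_one]
        ring
      rw [this, pow_add, ← pow_mul]
      field_simp
    rw [h1, mul_zero] at h2
    exact_mod_cast h2
  have hC0 : ∀ j, C j = 0 := by
    intro j
    rw [← Fin.rev_rev j]
    refine digits_eq_zero (2 ^ (4 * σ)) (fun j => C j.rev) (fun j => (hCle _).trans_lt hN) ?_ j.rev
    rw [← hsum, ← Equiv.sum_comp Fin.revPerm]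
    simp [Fin.val_rev]
  have hrow : ∀ j, A.adjugate i j = 0 := fun j => by
    have := hC j
    rw [hC0 j, Int.cast_zero, mul_eq_zero, or_iff_right hD] at this
    exact this
  -- A zero row of the adjugate would make the determinant vanish.
  have : (A.adjugate * A) i i = A.det := by simp [Matrix.adjugate_mul]
  rw [Matrix.mul_apply] at this
  simp only [hrow, zero_mul, Finset.sum_const_zero] at this
  exact hdet.ne_zero this.symm

end Nondegenerate

/-! ### Bordered minors and fraction-free elimination. -/

section Bordered

variable {R : Type*} [CommRing R] {n : ℕ}

/-- The minor with the rows and columns in `S`. -/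
def blockMinor (N : Matrix (Fin n) (Fin n) R) (S : Finset (Fin n)) : R :=
  (N.submatrix (fun i : {i // i ∈ S} => (i : Fin n)) (fun j : {j // j ∈ S} => (j : Fin n))).det

/-- The minor with the rows and columns in `S`, bordered by the row `i` and the column `j`. -/
def borderedMinor (N : Matrix (Fin n) (Fin n) R) (S : Finset (Fin n)) (i j : Fin n) : R :=
  (N.submatrix (Sum.elim (fun a : {a // a ∈ S} => (a : Fin n)) (fun _ : Unit => i))
    (Sum.elim (fun a : {a // a ∈ S} => (a : Fin n)) (fun _ : Unit => j))).det

theorem blockMinor_empty (N : Matrix (Fin n) (Fin n) R) : blockMinor N ∅ = 1 := by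
  simp [blockMinor]

theorem borderedMinor_empty (N : Matrix (Fin n) (Fin n) R) (i j : Fin n) :
    borderedMinor N ∅ i j = N i j := by
  let e : Unit ≃ {a : Fin n // a ∈ (∅ : Finset (Fin n))} ⊕ Unit := (Equiv.emptySum _ _).symm
  rw [borderedMinor, ← Matrix.det_submatrix_equiv_self e, Matrix.det_unique]
  rfl

/-- Identifies the pivot of an elimination step with the next minor on the chain. -/
theorem blockMinor_insert (N : Matrix (Fin n) (Fin n) R) {S : Finset (Fin n)} {k : Fin n}
    (hk : k ∉ S) : blockMinor N (insert k S) = borderedMinor N S k k := by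
  let f : {a // a ∈ S} ⊕ Unit → {a // a ∈ insert k S} :=
    Sum.elim (fun a => ⟨a, Finset.mem_insert_of_mem a.2⟩) fun _ => ⟨k, Finset.mem_insert_self _ _⟩
  have hf : Function.Bijective f := by
    constructor
    · rintro (⟨a, ha⟩ | _) (⟨b, hb⟩ | _) h <;> simp [f] at h ⊢
      · exact h
      · exact hk (h ▸ ha)
      · exact hk (h ▸ hb)
    · rintro ⟨a, ha⟩
      rcases Finset.mem_insert.1 ha with rfl | h
      · exact ⟨Sum.inr (), rfl⟩
      · exact ⟨Sum.inl ⟨a, h⟩, rfl⟩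
  rw [blockMinor, ← Matrix.det_submatrix_equiv_self (Equiv.ofBijective f hf), borderedMinor]
  congr 1
  ext x y
  rcases x with x | x <;> rcases y with y | y <;> rfl

/-- With `k` moved from the block to the border, the Schur complement of the block `S` is a 2 × 2
matrix. -/
theorem borderedMinor_insert_eq_det (N : Matrix (Fin n) (Fin n) R) {S : Finset (Fin n)}
    {k : Fin n} (hk : k ∉ S) (i j : Fin n) : borderedMinor N (insert k S) i j =
      (N.submatrix (Sum.elim (fun a : {a // a ∈ S} => (a : Fin n)) ![k, i])
        (Sum.elim (fun a : {a // a ∈ S} => (a : Fin n)) ![k, j])).det := by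
  let f : {a // a ∈ S} ⊕ Fin 2 → {a // a ∈ insert k S} ⊕ Unit :=
    Sum.elim (fun a => Sum.inl ⟨a, Finset.mem_insert_of_mem a.2⟩)
      ![Sum.inl ⟨k, Finset.mem_insert_self _ _⟩, Sum.inr ()]
  have hf : Function.Bijective f := by
    constructor
    · rintro (⟨a, ha⟩ | x) (⟨b, hb⟩ | y) h
      · simpa [f] using h
      · fin_cases y <;> simp [f] at h
        exact absurd (h ▸ ha) hk
      · fin_cases x <;> simp [f] at h
        exact absurd (h ▸ hb) hk
      · fin_cases x <;> fin_cases y <;> simp [f] at h ⊢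
    · rintro (⟨a, ha⟩ | _)
      · rcases Finset.mem_insert.1 ha with rfl | h
        · exact ⟨Sum.inr 0, rfl⟩
        · exact ⟨Sum.inl ⟨a, h⟩, rfl⟩
      · exact ⟨Sum.inr 1, rfl⟩
  rw [borderedMinor, ← Matrix.det_submatrix_equiv_self (Equiv.ofBijective f hf)]
  congr 1
  ext x y
  rcases x with x | x <;> rcases y with y | y
  · rfl
  · fin_cases y <;> rfl
  · fin_cases x <;> rfl
  · fin_cases x <;> fin_cases y <;> rfl

/-- Here `s` is the Schur complement N_ij - N_iS (N_S)⁻¹ N_Sj. One `s` serves all borders, which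
makes borders of one and of two rows comparable. -/
theorem det_bordered_eq_mul {K : Type*} [Field K] (N : Matrix (Fin n) (Fin n) K)
    (S : Finset (Fin n)) (hS : blockMinor N S ≠ 0) :
    ∃ s : Fin n → Fin n → K, ∀ (ι : Type) [Fintype ι] [DecidableEq ι] (f g : ι → Fin n),
      (N.submatrix (Sum.elim (fun a : {a // a ∈ S} => (a : Fin n)) f)
        (Sum.elim (fun a : {a // a ∈ S} => (a : Fin n)) g)).det =
      blockMinor N S * (Matrix.of fun x y => s (f x) (g y)).det := by
  set A := N.submatrix (fun i : {i // i ∈ S} => (i : Fin n)) (fun j : {j // j ∈ S} => (j : Fin n))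
    with hA
  have : Invertible A := A.invertibleOfIsUnitDet (isUnit_iff_ne_zero.2 hS)
  refine ⟨fun i j => N i j - ∑ b : {b // b ∈ S}, (∑ a : {a // a ∈ S}, N i a * (⅟A) a b) * N b j,
    fun ι _ _ f g => ?_⟩
  have h : N.submatrix (Sum.elim (fun a : {a // a ∈ S} => (a : Fin n)) f)
      (Sum.elim (fun a : {a // a ∈ S} => (a : Fin n)) g) =
      Matrix.fromBlocks A (N.submatrix (fun a : {a // a ∈ S} => (a : Fin n)) g)
        (N.submatrix f (fun a : {a // a ∈ S} => (a : Fin n))) (N.submatrix f g) := by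
    ext x y
    rcases x with x | x <;> rcases y with y | y <;> rfl
  rw [h, Matrix.det_fromBlocks₁₁]
  rfl

/-- The step of fraction-free elimination. -/
theorem blockMinor_mul_borderedMinor_insert {K : Type*} [Field K] (N : Matrix (Fin n) (Fin n) K)
    {S : Finset (Fin n)} {k : Fin n} (hk : k ∉ S) (hS : blockMinor N S ≠ 0) (i j : Fin n) :
    blockMinor N S * borderedMinor N (insert k S) i j =
      borderedMinor N S k k * borderedMinor N S i j -
        borderedMinor N S i k * borderedMinor N S k j := by
  obtain ⟨s, hs⟩ := det_bordered_eq_mul N S hS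
  have h1 : ∀ i j, borderedMinor N S i j = blockMinor N S * s i j := fun i j => by
    rw [borderedMinor, hs, Matrix.det_unique]
    rfl
  rw [borderedMinor_insert_eq_det N hk, hs, Matrix.det_fin_two, h1, h1, h1, h1]
  simp only [Matrix.of_apply, Matrix.cons_val_zero, Matrix.cons_val_one]
  ring

theorem cast_blockMinor (N : Matrix (Fin n) (Fin n) ℤ) (S : Finset (Fin n)) :
    ((blockMinor N S : ℤ) : ℚ) = blockMinor (N.map (Int.cast : ℤ → ℚ)) S :=
  RingHom.map_det (Int.castRingHom ℚ) _

theorem cast_borderedMinor (N : Matrix (Fin n) (Fin n) ℤ) (S : Finset (Fin n)) (i j : Fin n) :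
    ((borderedMinor N S i j : ℤ) : ℚ) = borderedMinor (N.map (Int.cast : ℤ → ℚ)) S i j :=
  RingHom.map_det (Int.castRingHom ℚ) _

/-- The division is exact because the quotient is a minor of an integer matrix; the identity itself
is transferred from `ℚ`. -/
theorem borderedMinor_insert_eq_ediv (N : Matrix (Fin n) (Fin n) ℤ)
    {S : Finset (Fin n)} {k : Fin n} (hk : k ∉ S) (hS : blockMinor N S ≠ 0) (i j : Fin n) :
    (borderedMinor N S k k * borderedMinor N S i j -
        borderedMinor N S i k * borderedMinor N S k j) / blockMinor N S =
      borderedMinor N (insert k S) i j := by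
  refine Int.ediv_eq_of_eq_mul_right hS ?_
  have h : blockMinor (N.map (Int.cast : ℤ → ℚ)) S ≠ 0 := by
    rw [← cast_blockMinor]
    exact_mod_cast hS
  have := blockMinor_mul_borderedMinor_insert (N.map (Int.cast : ℤ → ℚ)) hk h i j
  simp only [← cast_blockMinor, ← cast_borderedMinor] at this
  exact_mod_cast this.symm

/-- The Leibniz formula gives c! · 2^(bc) with c ≤ n + 1. This keeps the numbers in the elimination
at polynomial length. -/
theorem abs_borderedMinor_le (N : Matrix (Fin n) (Fin n) ℤ) (S : Finset (Fin n)) (i j : Fin n)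
    (b : ℕ) (h : ∀ i j, |N i j| ≤ 2 ^ b) :
    |borderedMinor N S i j| ≤ 2 ^ ((n + 1) * (n + 1 + b)) := by
  have h1 : |borderedMinor N S i j| ≤ _ := Matrix.det_le
    (A := N.submatrix (Sum.elim (fun a : {a // a ∈ S} => (a : Fin n)) (fun _ : Unit => i))
      (Sum.elim (fun a : {a // a ∈ S} => (a : Fin n)) (fun _ : Unit => j)))
    (abv := AbsoluteValue.abs) (x := 2 ^ b) fun _ _ => h _ _
  refine h1.trans ?_
  have hc : Fintype.card ({a // a ∈ S} ⊕ Unit) ≤ n + 1 := by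
    have := S.card_le_univ
    simpa using this
  generalize Fintype.card ({a // a ∈ S} ⊕ Unit) = c at hc
  have h2 : c.factorial ≤ 2 ^ ((n + 1) * (n + 1)) :=
    calc c.factorial ≤ c ^ c := Nat.factorial_le_pow c
      _ ≤ (2 ^ c) ^ c := Nat.pow_le_pow_left Nat.lt_two_pow_self.le _
      _ = 2 ^ (c * c) := (pow_mul _ _ _).symm
      _ ≤ _ := Nat.pow_le_pow_right two_pos (Nat.mul_le_mul hc hc)
  have h3 : ((2 : ℤ) ^ b) ^ c ≤ 2 ^ ((n + 1) * b) := by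
    rw [← pow_mul, mul_comm]
    exact pow_le_pow_right₀ one_le_two (Nat.mul_le_mul_right b hc)
  rw [nsmul_eq_mul, mul_add, pow_add]
  have h2' : ((c.factorial : ℕ) : ℤ) ≤ 2 ^ ((n + 1) * (n + 1)) := by exact_mod_cast h2
  gcongr

theorem cast_blockMinor_smul (M : Matrix (Fin n) (Fin n) ℚ) (N : Matrix (Fin n) (Fin n) ℤ) (D : ℚ)
    (h : ∀ i j, (N i j : ℚ) = D * M i j) (S : Finset (Fin n)) :
    ((blockMinor N S : ℤ) : ℚ) = D ^ S.card * principalMinor M S := by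
  rw [cast_blockMinor]
  have : N.map (Int.cast : ℤ → ℚ) = D • M := by
    ext i j
    simp [h]
  rw [this, blockMinor, Matrix.submatrix_smul, Pi.smul_apply, Pi.smul_apply, Matrix.det_smul,
    Fintype.card_coe]
  rfl

end Bordered

/-! ### Bit lengths and costs of expressions. -/

section Cost

theorem bits_le_iff (z : ℤ) (b : ℕ) : bits z ≤ b + 1 ↔ |z| < 2 ^ b := by
  rw [bits, Nat.add_le_add_iff_right, Nat.size_le, Int.abs_eq_natAbs]
  exact_mod_cast Iff.rfl

theorem abs_lt_two_pow_size (z : ℤ) : |z| < 2 ^ Nat.size z.natAbs := (bits_le_iff z _).1 le_rfl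

theorem one_le_bits (z : ℤ) : 1 ≤ bits z := Nat.le_add_left 1 _

theorem bits_add_le (x y : ℤ) : bits (x + y) ≤ bits x + bits y := by
  have hx := abs_lt_two_pow_size x
  have hy := abs_lt_two_pow_size y
  have h := abs_add_le x y
  have h1 : (2 : ℤ) ^ x.natAbs.size ≤ 2 ^ (x.natAbs.size + y.natAbs.size) :=
    pow_le_pow_right₀ one_le_two (by omega)
  have h2 : (2 : ℤ) ^ y.natAbs.size ≤ 2 ^ (x.natAbs.size + y.natAbs.size) :=
    pow_le_pow_right₀ one_le_two (by omega)
  have := (bits_le_iff (x + y) (x.natAbs.size + y.natAbs.size + 1)).2 (by rw [pow_succ]; omega)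
  simp only [bits] at this ⊢
  omega

theorem bits_sub_le (x y : ℤ) : bits (x - y) ≤ bits x + bits y := by
  have := bits_add_le x (-y)
  rwa [← sub_eq_add_neg, show bits (-y) = bits y by simp [bits]] at this

theorem bits_mul_le (x y : ℤ) : bits (x * y) ≤ bits x + bits y := by
  have := (bits_le_iff (x * y) (x.natAbs.size + y.natAbs.size)).2 (by
    rw [abs_mul, pow_add]
    exact mul_lt_mul'' (abs_lt_two_pow_size x) (abs_lt_two_pow_size y) (abs_nonneg _)
      (abs_nonneg _))
  simp only [bits] at this ⊢
  omega

theorem bits_ediv_le (x y : ℤ) : bits (x / y) ≤ bits x :=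
  Nat.succ_le_succ (Nat.size_le_size (Int.natAbs_ediv_le_natAbs x y))

/-- A size of expressions that takes the literals into account. -/
def Expr.size : Expr → ℕ
  | .lit z => bits z
  | .get _ e => e.size + 1
  | .add e f => e.size + f.size + 1
  | .sub e f => e.size + f.size + 1
  | .mul e f => e.size + f.size + 1
  | .div e f => e.size + f.size + 1

/-- Every entry of the memory has absolute value less than `2 ^ L`. -/
def Mem.BoundedBy (m : Mem) (L : ℕ) : Prop := ∀ k j, |m k j| < 2 ^ L

/-- Bit length is subadditive under each operation, and a read value is bounded by the memory,
whatever its index. -/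
theorem Expr.bits_eval_le {m : Mem} {L : ℕ} (hm : m.BoundedBy L) (e : Expr) :
    bits (e.eval m) ≤ e.size * (L + 1) := by
  induction e with
  | lit z => exact Nat.le_mul_of_pos_right _ L.succ_pos
  | get k e ih =>
    exact ((bits_le_iff _ _).2 (hm _ _)).trans (Nat.le_mul_of_pos_left _ (Nat.succ_pos _))
  | add e f ihe ihf => exact (bits_add_le _ _).trans (by simp only [Expr.size, add_mul]; omega)
  | sub e f ihe ihf => exact (bits_sub_le _ _).trans (by simp only [Expr.size, add_mul]; omega)
  | mul e f ihe ihf => exact (bits_mul_le _ _).trans (by simp only [Expr.size, add_mul]; omega)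
  | div e f ihe ihf => exact (bits_ediv_le _ _).trans (by simp only [Expr.size, add_mul]; omega)

/-- There are at most `e.size` subexpressions, each with a value of at most `e.size` words; hence
the square. -/
theorem Expr.cost_le {m : Mem} {L : ℕ} (hm : m.BoundedBy L) (e : Expr) :
    e.cost m ≤ e.size ^ 2 * (L + 1) := by
  have key : ∀ (a b c d s : ℕ), c ≤ a ^ 2 * (L + 1) → d ≤ b ^ 2 * (L + 1) →
      s ≤ (a + b + 1) * (L + 1) → c + d + s ≤ (a + b + 1) ^ 2 * (L + 1) := by
    intro a b c d s hc hd hs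
    have : a ^ 2 * (L + 1) + b ^ 2 * (L + 1) + (a + b + 1) * (L + 1) ≤
        (a + b + 1) ^ 2 * (L + 1) := by
      rw [← add_mul, ← add_mul]
      exact Nat.mul_le_mul_right _ (by nlinarith)
    omega
  induction e with
  | lit z =>
    have h := one_le_bits z
    simp only [Expr.cost, Expr.size]
    nlinarith [Nat.zero_le (bits z * bits z * L), Nat.mul_le_mul h h]
  | get k e ih =>
    have := key e.size 0 _ 0 _ ih (by simp) (Expr.bits_eval_le hm (.get k e))
    simp only [add_zero] at this
    exact this
  | add e f ihe ihf => exact key _ _ _ _ _ ihe ihf (Expr.bits_eval_le hm (.add e f))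
  | sub e f ihe ihf => exact key _ _ _ _ _ ihe ihf (Expr.bits_eval_le hm (.sub e f))
  | mul e f ihe ihf => exact key _ _ _ _ _ ihe ihf (Expr.bits_eval_le hm (.mul e f))
  | div e f ihe ihf => exact key _ _ _ _ _ ihe ihf (Expr.bits_eval_le hm (.div e f))

/-- A bound for the cost of a single pass through a program, in units of the word length. -/
def Prog.weight : Prog → ℕ
  | .skip => 1
  | .set _ e f => e.size ^ 2 + f.size ^ 2 + 1
  | .seq c d => c.weight + d.weight + 1
  | .ite e c d => e.size ^ 2 + c.weight + d.weight + 1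
  | .loop e c => e.size ^ 2 + c.weight + 1

end Cost

/-! ### A calculus for total correctness with cost bounds. -/

section Hoare

/-- Store the value `v` in array `k` at index `j`. -/
def Mem.put (m : Mem) (k j : ℕ) (v : ℤ) : Mem := Function.update m k (Function.update (m k) j v)

theorem Mem.put_apply (m : Mem) (k j : ℕ) (v : ℤ) (k' j' : ℕ) :
    m.put k j v k' j' = if k' = k ∧ j' = j then v else m k' j' := by
  by_cases hk : k' = k
  · subst hk
    by_cases hj : j' = j <;> simp [Mem.put, hj]
  · simp [Mem.put, hk]

theorem Mem.put_of_ne (m : Mem) {k k' : ℕ} (j : ℕ) (v : ℤ) (h : k' ≠ k) : m.put k j v k' = m k' := by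
  simp [Mem.put, h]

theorem Mem.BoundedBy.put {m : Mem} {L : ℕ} (hm : m.BoundedBy L) (k j : ℕ) {v : ℤ}
    (hv : |v| < 2 ^ L) : (m.put k j v).BoundedBy L := by
  intro k' j'
  rw [Mem.put_apply]
  split_ifs
  exacts [hv, hm _ _]

/-- Started in `m`, the program `c` halts in a memory with property `Q`, at a cost of at most `s`
passes through it with words of length `L + 1`. -/
def Achieves (L s : ℕ) (c : Prog) (m : Mem) (Q : Mem → Prop) : Prop :=
  ∃ m' t, Run c m m' t ∧ t ≤ c.weight * s * (L + 1) ∧ Q m'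

variable {L s : ℕ}

theorem Achieves.mono {c : Prog} {m : Mem} {Q Q' : Mem → Prop} {s' : ℕ}
    (h : Achieves L s c m Q) (hs : s ≤ s') (hQ : ∀ m', Q m' → Q' m') : Achieves L s' c m Q' := by
  obtain ⟨m', t, hr, ht, hq⟩ := h
  exact ⟨m', t, hr, ht.trans (by gcongr), hQ _ hq⟩

theorem Achieves.set {m : Mem} {Q : Mem → Prop} (hm : m.BoundedBy L) (hs : 1 ≤ s) (k : ℕ)
    (e f : Expr) (h : Q (m.put k (e.eval m).toNat (f.eval m))) :
    Achieves L s (.set k e f) m Q := by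
  refine ⟨_, _, Run.set k e f m, ?_, h⟩
  have he := e.cost_le hm
  have hf := f.cost_le hm
  calc e.cost m + f.cost m + 1
      ≤ (e.size ^ 2 + f.size ^ 2 + 1) * 1 * (L + 1) := by
        simp only [mul_one, add_mul]
        omega
    _ ≤ _ := by
        simp only [Prog.weight]
        gcongr

/-- Weights add up, so both parts can be given the same number of passes. -/
theorem Achieves.seq {c d : Prog} {m : Mem} {Q : Mem → Prop} (hs : 1 ≤ s)
    (h : Achieves L s c m fun m' => Achieves L s d m' Q) : Achieves L s (.seq c d) m Q := by
  obtain ⟨m₁, t, hr, ht, m₂, u, hr', hu, hq⟩ := h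
  refine ⟨m₂, _, Run.seq hr hr', ?_, hq⟩
  have : 1 ≤ s * (L + 1) := Nat.mul_pos hs L.succ_pos
  simp only [Prog.weight, add_mul, one_mul]
  simp only [Nat.mul_assoc] at *
  omega

theorem Achieves.ite {e : Expr} {c d : Prog} {m : Mem} {Q : Mem → Prop} (hm : m.BoundedBy L)
    (hs : 1 ≤ s) (hc : 0 < e.eval m → Achieves L s c m Q)
    (hd : ¬ 0 < e.eval m → Achieves L s d m Q) : Achieves L s (.ite e c d) m Q := by
  have he : e.cost m ≤ e.size ^ 2 * s * (L + 1) := (e.cost_le hm).trans (by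
    gcongr
    exact Nat.le_mul_of_pos_right _ hs)
  have h1 : 1 ≤ s * (L + 1) := Nat.mul_pos hs L.succ_pos
  by_cases h : 0 < e.eval m
  · obtain ⟨m', t, hr, ht, hq⟩ := hc h
    refine ⟨m', _, Run.ite_pos h hr, ?_, hq⟩
    simp only [Prog.weight, add_mul, one_mul, Nat.mul_assoc] at *
    omega
  · obtain ⟨m', t, hr, ht, hq⟩ := hd h
    refine ⟨m', _, Run.ite_neg h hr, ?_, hq⟩
    simp only [Prog.weight, add_mul, one_mul, Nat.mul_assoc] at *
    omega

/-- The rule for loops with a bound `N` for the number of iterations. -/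
theorem Achieves.loop {e : Expr} {c : Prog} (I : ℕ → Mem → Prop) (hs : 1 ≤ s)
    (hI : ∀ i m, I i m → m.BoundedBy L) (N : ℕ)
    (hstep : ∀ i m, I i m → 0 < e.eval m → i < N ∧ Achieves L s c m (I (i + 1)))
    {m : Mem} (h0 : I 0 m) :
    Achieves L ((N + 1) * s) (.loop e c) m fun m' => ∃ i ≤ N, I i m' ∧ ¬ 0 < e.eval m' := by
  -- At most `j` iterations remain; the additional pass pays for the last test.
  have main : ∀ j i m, i + j = N → I i m → Achieves L ((j + 1) * s) (.loop e c) m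
      fun m' => ∃ i ≤ N, I i m' ∧ ¬ 0 < e.eval m' := by
    have h1 : 1 ≤ s * (L + 1) := Nat.mul_pos hs L.succ_pos
    have hcost : ∀ i m, I i m → e.cost m ≤ e.size ^ 2 * (s * (L + 1)) := fun i m hi =>
      (e.cost_le (hI i m hi)).trans (Nat.mul_le_mul_left _ (Nat.le_mul_of_pos_left _ hs))
    have hhalt : ∀ j i m, i + j = N → I i m → ¬ 0 < e.eval m →
        Achieves L ((j + 1) * s) (.loop e c) m
          fun m' => ∃ i ≤ N, I i m' ∧ ¬ 0 < e.eval m' := by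
      intro j i m hij hi h
      refine ⟨m, _, Run.loop_stop h, ?_, i, by omega, hi, h⟩
      have := hcost i m hi
      calc e.cost m + 1 ≤ (e.size ^ 2 + c.weight + 1) * (s * (L + 1)) := by
            simp only [add_mul, one_mul]
            omega
        _ ≤ (e.size ^ 2 + c.weight + 1) * ((j + 1) * s * (L + 1)) := by
            rw [Nat.mul_assoc (j + 1)]
            exact Nat.mul_le_mul_left _ (Nat.le_mul_of_pos_left _ j.succ_pos)
        _ = _ := by rw [Prog.weight, ← Nat.mul_assoc]
    intro j
    induction j with
    | zero =>
      intro i m hij hi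
      exact hhalt 0 i m hij hi fun h => by have := (hstep i m hi h).1; omega
    | succ j ih =>
      intro i m hij hi
      by_cases h : 0 < e.eval m
      · obtain ⟨m₁, t, hr, ht, hi'⟩ := (hstep i m hi h).2
        obtain ⟨m₂, u, hr', hu, hq⟩ := ih (i + 1) m₁ (by omega) hi'
        refine ⟨m₂, _, Run.loop_step h hr hr', ?_, hq⟩
        have := hcost i m hi
        have ht' : t ≤ c.weight * (s * (L + 1)) := by rwa [← Nat.mul_assoc]
        calc e.cost m + t + u + 1
            ≤ (e.size ^ 2 + c.weight + 1) * (s * (L + 1)) +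
                (e.size ^ 2 + c.weight + 1) * ((j + 1) * s) * (L + 1) := by
              simp only [Prog.weight] at hu
              rw [add_mul _ 1 (s * (L + 1)), add_mul _ _ (s * (L + 1)), one_mul]
              omega
          _ = _ := by
              rw [Prog.weight]
              ring
      · exact hhalt _ i m hij hi h
  exact main N 0 m (by omega) h0

theorem Achieves.set_eq {m : Mem} {Q : Mem → Prop} (hm : m.BoundedBy L) (hs : 1 ≤ s) {k : ℕ}
    {e f : Expr} (j : ℕ) (v : ℤ) (he : e.eval m = j) (hf : f.eval m = v) (h : Q (m.put k j v)) :
    Achieves L s (.set k e f) m Q := by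
  refine Achieves.set hm hs k e f ?_
  rwa [he, hf, Int.toNat_natCast]

theorem Achieves.ite_set {m : Mem} {Q : Mem → Prop} (hm : m.BoundedBy L) (hs : 1 ≤ s) {k : ℕ}
    {e i f g : Expr} (j : ℕ) (v w : ℤ) {p : Prop} [Decidable p] (he : 0 < e.eval m ↔ p)
    (hi : i.eval m = j) (hf : f.eval m = v) (hg : g.eval m = w)
    (h : Q (m.put k j (if p then v else w))) :
    Achieves L s (.ite e (.set k i f) (.set k i g)) m Q := by
  refine .ite hm hs (fun hc => .set_eq hm hs j v hi hf ?_) fun hc => .set_eq hm hs j w hi hg ?_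
  · rwa [if_pos (he.1 hc)] at h
  · rwa [if_neg (mt he.2 hc)] at h

/-- Entry `0` of array `k`. -/
abbrev Expr.reg (k : ℕ) : Expr := .get k (.lit 0)

/-- Execute `c` with entry `0` of array `7` running from `0` up to the value of `e`. -/
def Prog.for (e : Expr) (c : Prog) : Prog :=
  .seq (.set 7 (.lit 0) (.lit 0))
    (.loop (.sub e (.reg 7)) (.seq c (.set 7 (.lit 0) (.add (.reg 7) (.lit 1)))))

/-- The loop itself overwrites its counter, so the invariant has to survive that (`hput`), and `hN`
keeps the counter within the word length. -/
theorem Achieves.for {e : Expr} {c : Prog} (I : ℕ → Mem → Prop) (hs : 1 ≤ s) (N : ℕ)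
    (hN : (N : ℤ) < 2 ^ L) (hI : ∀ i m, I i m → m.BoundedBy L ∧ e.eval m = N)
    (hput : ∀ i m (v : ℤ), |v| < 2 ^ L → I i m → I i (m.put 7 0 v))
    (hstep : ∀ i m, i < N → I i m → m 7 0 = i →
      Achieves L s c m fun m' => I (i + 1) m' ∧ m' 7 0 = i)
    {m : Mem} (hm : m.BoundedBy L) (h0 : ∀ m' : Mem, m' = m.put 7 0 0 → I 0 m') :
    Achieves L ((N + 1) * s) (.for e c) m (I N) := by
  have hs' : 1 ≤ (N + 1) * s := Nat.mul_pos N.succ_pos hs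
  refine Achieves.seq hs' (Achieves.set_eq hm hs' 0 0 rfl rfl ?_)
  refine (Achieves.loop (fun i m => i ≤ N ∧ I i m ∧ m 7 0 = i) hs (fun i m h => (hI i m h.2.1).1) N
    (fun i m h hpos => ?_) ⟨N.zero_le, h0 _ rfl, by simp [Mem.put_apply]⟩).mono le_rfl ?_
  · have hlt : i < N := by
      simp only [Expr.eval, (hI i m h.2.1).2, Int.toNat_zero, h.2.2] at hpos
      omega
    refine ⟨hlt, Achieves.seq hs ((hstep i m hlt h.2.1 h.2.2).mono le_rfl fun m' h' => ?_)⟩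
    refine Achieves.set_eq (hI _ m' h'.1).1 hs 0 (i + 1 : ℕ) rfl (by simp [Expr.eval, h'.2])
      ⟨hlt, hput _ _ _ ?_ h'.1, by simp [Mem.put_apply]⟩
    rw [abs_of_nonneg (by positivity)]
    exact lt_of_le_of_lt (by exact_mod_cast hlt) hN
  · rintro m' ⟨i, -, ⟨hi, h, h7⟩, hneg⟩
    simp only [Expr.eval, (hI i m' h).2, Int.toNat_zero, h7] at hneg
    rwa [show N = i by omega]

/-- The memories agree except possibly for the arrays in `A`. -/
def Mem.AgreeOff (A : List ℕ) (m m₀ : Mem) : Prop := ∀ k ∉ A, m k = m₀ k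

theorem Mem.AgreeOff.refl (A : List ℕ) (m : Mem) : Mem.AgreeOff A m m := fun _ _ => rfl

theorem Mem.AgreeOff.put {A : List ℕ} {m m₀ : Mem} (h : Mem.AgreeOff A m m₀) {k : ℕ} (hk : k ∈ A)
    (j : ℕ) (v : ℤ) : Mem.AgreeOff A (m.put k j v) m₀ := fun k' hk' =>
  (m.put_of_ne j v (ne_of_mem_of_not_mem hk hk').symm).trans (h k' hk')

theorem Mem.AgreeOff.trans {A B C : List ℕ} {m m₁ m₂ : Mem} (h : Mem.AgreeOff A m m₁)
    (h' : Mem.AgreeOff B m₁ m₂) (hA : A ⊆ C) (hB : B ⊆ C) : Mem.AgreeOff C m m₂ := fun k hk =>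
  (h k fun hk' => hk (hA hk')).trans (h' k fun hk' => hk (hB hk'))

end Hoare

open PMatrixUSO.Expr (reg)

/-! ### The program. -/

section Program

/-- Multiply entry `0` of array `8` by `2 ^ Nat.size a`, where `a` is entry `0` of array `10`. -/
def sizeProg : Prog :=
  .loop (reg 10) (.seq (.set 8 (.lit 0) (.add (reg 8) (reg 8)))
    (.set 10 (.lit 0) (.div (reg 10) (.lit 2))))

/-- Compute `2 ^ σ` in array `8` and the product of all denominators in array `9`. -/
def scanProg : Prog :=
  -- Arrays 0 to 3 hold dimension, numerators, denominators and set. Array 5 holds the elimination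
  -- layers, 7 the counter, 10 the number being measured, 11 the elimination step and 12 the
  -- divisor.
  .seq (.set 8 (.lit 0) (.lit 1)) <| .seq (.set 9 (.lit 0) (.lit 1)) <|
  .for (.mul (reg 0) (reg 0)) <|
    -- This doubling accounts for the sign bit of the entry.
    .seq (.set 8 (.lit 0) (.add (reg 8) (reg 8))) <|
    .seq (.ite (.get 1 (reg 7)) (.set 10 (.lit 0) (.get 1 (reg 7)))
      (.set 10 (.lit 0) (.sub (.lit 0) (.get 1 (reg 7))))) <|
    .seq sizeProg <|
    .seq (.set 10 (.lit 0) (.get 2 (reg 7))) <|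
    .seq sizeProg <|
    .set 9 (.lit 0) (.mul (reg 9) (.get 2 (reg 7)))

/-- Compute the integer matrix `D • M` in array `5`. -/
def scaleProg : Prog :=
  .for (.mul (reg 0) (reg 0)) <|
    .set 5 (reg 7) (.mul (.get 1 (reg 7)) (.div (reg 9) (.get 2 (reg 7))))

/-- The current layer of array `5`, at the position given by an expression. -/
def layer (e : Expr) : Expr := .get 5 (.add (.mul (reg 11) (.mul (reg 0) (reg 0))) e)

/-- The current pivot. -/
def pivot : Expr := layer (.add (.mul (reg 11) (reg 0)) (reg 11))

/-- The entry of the set at the current elimination step. -/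
def flag : Expr := .get 3 (reg 11)

/-- One step of fraction-free elimination. -/
def stepProg : Prog :=
  .for (.mul (reg 0) (reg 0)) <|
    .set 5 (.add (.mul (.add (reg 11) (.lit 1)) (.mul (reg 0) (reg 0))) (reg 7))
      -- The flag is 0 or 1 and selects between the eliminated entry and a copy of the old one.
      (.add (.mul flag (.div
          (.sub (.mul pivot (layer (reg 7)))
            -- For a position q = i·n + j, the term (q / n)·n is the start of row i, and its
            -- difference to q is j.
            (.mul (layer (.add (.mul (.div (reg 7) (reg 0)) (reg 0)) (reg 11)))
              (layer (.add (.mul (reg 11) (reg 0))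
                (.sub (reg 7) (.mul (.div (reg 7) (reg 0)) (reg 0)))))))
          (reg 12)))
        (.mul (.sub (.lit 1) flag) (layer (reg 7))))

/-- Eliminate until a pivot is not positive. -/
def elimProg : Prog :=
  .seq (.set 11 (.lit 0) (.lit 0)) <| .seq (.set 12 (.lit 0) (.lit 1)) <|
  -- The test passes for an index outside the set, or if the pivot is positive.
  .loop (.add (.sub (.lit 1) flag) (.mul flag pivot)) <|
    .seq stepProg <|
    .seq (.set 12 (.lit 0) (.add (.mul flag pivot) (.mul (.sub (.lit 1) flag) (reg 12)))) <|
    .set 11 (.lit 0) (.add (reg 11) (.lit 1))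

/-- Write the output. -/
def outputProg : Prog :=
  .seq (.set 13 (.lit 0) (.mul (.mul (reg 8) (reg 8)) (.mul (reg 8) (reg 8)))) <|
  .seq (.set 14 (.lit 0) (.lit 1)) <|
  .seq (.for (reg 0) <|
    .seq (.set 14 (.lit 0) (.mul (reg 14) (reg 13))) <|
    .seq (.set 4 (reg 7) (reg 14)) <|
    .seq (.ite (.sub (.add (reg 11) (.lit 1)) (reg 7)) (.set 1 (reg 7) (.get 3 (reg 7)))
      (.set 1 (reg 7) (.lit 0))) <|
    .seq (.ite (.sub (reg 11) (reg 7)) (.set 2 (reg 7) (.get 3 (reg 7)))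
      (.set 2 (reg 7) (.lit 0))) <|
    -- The set in array 3 is overwritten by the numerators `1` only after its entry has been copied.
    .set 3 (reg 7) (.lit 1)) <|
  -- The tag replaces the dimension last, since the pivot is located by means of the dimension.
  .ite (.sub (.lit 0) pivot) (.set 0 (.lit 0) (.lit 1)) (.set 0 (.lit 0) (.lit 0))

/-- The conversion of a nonpositive principal minor into a failed unique sink orientation. -/
def solver : Prog := .seq scanProg <| .seq scaleProg <| .seq elimProg outputProg

end Program

/-! ### Correctness of scanning and scaling. -/

section Scan

variable {L s : ℕ}

theorem Achieves.sizeProg {m : Mem} (hs : 1 ≤ s) (hm : m.BoundedBy L) {a : ℕ} {p : ℤ} (hp : 0 ≤ p)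
    (ha : m 10 0 = a) (h8 : m 8 0 = p) (hL : p * 2 ^ Nat.size a < 2 ^ L) :
    Achieves L ((Nat.size a + 1) * s) sizeProg m fun m' => m'.BoundedBy L ∧
      m'.AgreeOff [8, 10] m ∧ m' 8 0 = p * 2 ^ Nat.size a := by
  -- The quotient a / 2^i first vanishes at i = `Nat.size a`, so the loop doubles exactly that
  -- often.
  refine (Achieves.loop (fun i m' => i ≤ Nat.size a ∧ m'.BoundedBy L ∧ m'.AgreeOff [8, 10] m ∧
    m' 8 0 = p * 2 ^ i ∧ m' 10 0 = (a / 2 ^ i : ℕ)) hs (fun i m' h => h.2.1) (Nat.size a) ?_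
    ⟨Nat.zero_le _, hm, .refl _ _, by simp [h8], by simp [ha]⟩).mono le_rfl ?_
  · rintro i m' ⟨hi, hB, hA, h8, h10⟩ hpos
    have hlt : i < Nat.size a := by
      simp only [Expr.eval, Int.toNat_zero, h10] at hpos
      rw [Nat.lt_size]
      by_contra hlt
      rw [Nat.div_eq_of_lt (not_le.1 hlt)] at hpos
      simp at hpos
    have hb : ∀ v : ℤ, 0 ≤ v → v ≤ p * 2 ^ (i + 1) → |v| < 2 ^ L := fun v h0 h1 => by
      rw [abs_of_nonneg h0]
      refine (h1.trans ?_).trans_lt hL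
      gcongr
      exacts [one_le_two, hlt]
    have hB' := hB.put 8 0 (hb (p * 2 ^ (i + 1)) (by positivity) le_rfl)
    refine ⟨hlt, .seq hs (.set_eq hB hs 0 (p * 2 ^ (i + 1)) rfl
      (by simp [Expr.eval, h8, pow_succ]; ring) (.set_eq hB' hs 0 (a / 2 ^ (i + 1) : ℕ) rfl ?_ ?_))⟩
    · simp [Expr.eval, Mem.put_apply, h10, pow_succ, ← Int.ediv_ediv_of_nonneg]
    · refine ⟨hlt, hB'.put _ _ ?_, (hA.put (by simp) _ _).put (by simp) _ _, ?_, ?_⟩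
      · have := hB 10 0
        rw [h10, abs_of_nonneg (by positivity)] at this
        rw [abs_of_nonneg (by positivity)]
        refine lt_of_le_of_lt ?_ this
        rw [pow_succ, ← Nat.div_div_eq_div_mul]
        exact_mod_cast Nat.div_le_self _ _
      · simp [Mem.put_apply]
      · simp [Mem.put_apply]
  · rintro m' ⟨i, -, ⟨hi, hB, hA, h8, h10⟩, hneg⟩
    have : i = Nat.size a := by
      refine le_antisymm hi (Nat.size_le.2 ?_)
      simp only [Expr.eval, Int.toNat_zero, h10] at hneg
      by_contra hlt
      have := Nat.div_pos (not_lt.1 hlt) (by positivity)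
      omega
    exact ⟨hB, hA, this ▸ h8⟩

/-- The number of bits of the first `k` entries of a list of fractions. -/
def scanBits (num den : ℕ → ℤ) (k : ℕ) : ℕ :=
  ∑ q ∈ Finset.range k, (1 + Nat.size (num q).natAbs + Nat.size (den q).natAbs)

/-- The product of the first `k` denominators. -/
def scanDen (den : ℕ → ℤ) (k : ℕ) : ℤ := ∏ q ∈ Finset.range k, den q

theorem abs_scanDen_le (num den : ℕ → ℤ) (k : ℕ) : |scanDen den k| ≤ 2 ^ scanBits num den k := by
  rw [scanDen, scanBits, Finset.abs_prod, ← Finset.prod_pow_eq_pow_sum]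
  refine Finset.prod_le_prod (fun _ _ => abs_nonneg _) fun q _ => ?_
  exact (abs_lt_two_pow_size _).le.trans (pow_le_pow_right₀ one_le_two (by omega))

theorem Achieves.scanProg {m : Mem} (hm : m.BoundedBy L) {n b : ℕ} (hn : m 0 0 = n)
    (hnL : ((n * n : ℕ) : ℤ) < 2 ^ L) (hden : ∀ q, 0 ≤ m 2 q)
    (hb : scanBits (m 1) (m 2) (n * n) ≤ b) (hbL : b < L) :
    Achieves L ((n * n + 1) * (b + 1)) scanProg m fun m' => m'.BoundedBy L ∧
      m'.AgreeOff [7, 8, 9, 10] m ∧ m' 8 0 = 2 ^ scanBits (m 1) (m 2) (n * n) ∧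
      m' 9 0 = scanDen (m 2) (n * n) := by
  have hs : 1 ≤ (n * n + 1) * (b + 1) := Nat.mul_pos (Nat.succ_pos _) (Nat.succ_pos _)
  have hs1 : 1 ≤ b + 1 := Nat.succ_pos _
  have h1L : |(1 : ℤ)| < 2 ^ L := by
    rw [abs_one]
    exact one_lt_pow₀ one_lt_two (by omega)
  have hmono : ∀ i ≤ n * n, scanBits (m 1) (m 2) i ≤ b := fun i hi =>
    (Finset.sum_le_sum_of_subset (Finset.range_mono hi)).trans hb
  have hpow : ∀ e ≤ b, (2 : ℤ) ^ e < 2 ^ L := fun e he =>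
    pow_lt_pow_right₀ one_lt_two (he.trans_lt hbL)
  have hB8 := hm.put 8 0 h1L
  have hB9 := hB8.put 9 0 h1L
  refine .seq hs (.set_eq hm hs 0 1 rfl rfl (.seq hs (.set_eq hB8 hs 0 1 rfl rfl ?_)))
  refine (Achieves.for (fun i m' => m'.BoundedBy L ∧ m'.AgreeOff [7, 8, 9, 10] m ∧
    m' 8 0 = 2 ^ scanBits (m 1) (m 2) i ∧ m' 9 0 = scanDen (m 2) i) hs1 (n * n) hnL
    ?_ ?_ ?_ hB9 ?_).mono le_rfl fun m' h => h
  · rintro i m' ⟨hB, hA, -, -⟩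
    refine ⟨hB, ?_⟩
    have : m' 0 0 = n := by rw [hA 0 (by simp), hn]
    simp [Expr.eval, this]
  · rintro i m' v hv ⟨hB, hA, h8, h9⟩
    exact ⟨hB.put _ _ hv, hA.put (by simp) _ _, by simpa [Mem.put_apply] using h8,
      by simpa [Mem.put_apply] using h9⟩
  · rintro i m₀ hi ⟨hB, hA, h8, h9⟩ h7
    have hm1 : m₀ 1 = m 1 := hA 1 (by simp)
    have hm2 : m₀ 2 = m 2 := hA 2 (by simp)
    set e := scanBits (m 1) (m 2) i with he
    have hsucc : scanBits (m 1) (m 2) (i + 1) =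
        e + (1 + Nat.size (m 1 i).natAbs + Nat.size (m 2 i).natAbs) := Finset.sum_range_succ _ _
    have hle := hmono (i + 1) hi
    rw [hsucc] at hle ⊢
    have hB1 := hB.put 8 0 (v := 2 ^ (e + 1)) (by
      rw [abs_of_nonneg (by positivity)]
      exact hpow _ (by omega))
    refine .seq hs1 (.set_eq hB hs1 0 (2 ^ (e + 1)) rfl
      (by simp [Expr.eval, h8, pow_succ]; ring) ?_)
    have hA1 := hA.put (k := 8) (by simp) 0 (2 ^ (e + 1))
    have h71 : (m₀.put 8 0 (2 ^ (e + 1))) 7 0 = i := by simpa [Mem.put_apply] using h7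
    have h81 : (m₀.put 8 0 (2 ^ (e + 1))) 8 0 = 2 ^ (e + 1) := by simp [Mem.put_apply]
    have h91 : (m₀.put 8 0 (2 ^ (e + 1))) 9 0 = scanDen (m 2) i := by
      simpa [Mem.put_apply] using h9
    generalize m₀.put 8 0 (2 ^ (e + 1)) = m₁ at hB1 hA1 h71 h81 h91 ⊢
    have h11 : m₁ 1 i = m 1 i := by rw [hA1 1 (by simp)]
    have hab : |(((m 1 i).natAbs : ℕ) : ℤ)| < 2 ^ L := by
      rw [Nat.abs_cast, ← Int.abs_eq_natAbs, ← h11]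
      exact hB1 1 i
    have hite : Achieves L (b + 1) (.ite (.get 1 (reg 7)) (.set 10 (.lit 0) (.get 1 (reg 7)))
        (.set 10 (.lit 0) (.sub (.lit 0) (.get 1 (reg 7))))) m₁
        fun m' => m' = m₁.put 10 0 ((m 1 i).natAbs : ℕ) := by
      refine .ite hB1 hs1 (fun hpos => ?_) (fun hneg => ?_)
      · simp only [Expr.eval, Int.toNat_zero, h71, Int.toNat_natCast, h11] at hpos
        refine .set_eq hB1 hs1 0 _ rfl ?_ rfl
        simp [Expr.eval, h71, h11, abs_of_pos hpos]
      · simp only [Expr.eval, Int.toNat_zero, h71, Int.toNat_natCast, h11] at hneg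
        refine .set_eq hB1 hs1 0 _ rfl ?_ rfl
        simp [Expr.eval, h71, h11, abs_of_nonpos (not_lt.1 hneg)]
    refine .seq hs1 (hite.mono le_rfl ?_)
    rintro _ rfl
    -- The passes of this inner loop fit into `b + 1`, because the measured bits are part of a sum
    -- bounded by `b`.
    refine .seq hs1 ((Achieves.sizeProg (s := 1) le_rfl (hB1.put _ _ hab)
      (a := (m 1 i).natAbs) (p := 2 ^ (e + 1))
      (by positivity) (by simp [Mem.put_apply]) (by simpa [Mem.put_apply] using h81) ?_).mono ?_ ?_)
    · rw [← pow_add]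
      exact hpow _ (by omega)
    · omega
    rintro m₂ ⟨hB2, hA2, h82⟩
    have hA2' : m₂.AgreeOff [8, 10] m₁ := fun k hk => by
      rw [hA2 k hk, Mem.put_of_ne]
      rintro rfl
      simp at hk
    have h72 : m₂ 7 0 = i := by rw [hA2' 7 (by simp), h71]
    have h22 : m₂ 2 = m 2 := by rw [hA2' 2 (by simp), hA1 2 (by simp)]
    have hb10 : |(((m 2 i).natAbs : ℕ) : ℤ)| < 2 ^ L := by
      rw [Nat.abs_cast, ← Int.abs_eq_natAbs, ← h22]
      exact hB2 2 i
    refine .seq hs1 (.set_eq hB2 hs1 0 ((m 2 i).natAbs : ℕ) rfl ?_ ?_)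
    · simp [Expr.eval, h72, h22, abs_of_nonneg (hden i)]
    rw [← pow_add] at h82
    refine .seq hs1 ((Achieves.sizeProg (s := 1) le_rfl (hB2.put _ _ hb10)
      (a := (m 2 i).natAbs)
      (p := 2 ^ (e + 1 + Nat.size (m 1 i).natAbs))
      (by positivity) (by simp [Mem.put_apply]) (by simpa [Mem.put_apply] using h82) ?_).mono ?_ ?_)
    · rw [← pow_add]
      exact hpow _ (by omega)
    · omega
    rintro m₃ ⟨hB3, hA3, h83⟩
    have hA3' : m₃.AgreeOff [8, 10] m₂ := fun k hk => by
      rw [hA3 k hk, Mem.put_of_ne]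
      rintro rfl
      simp at hk
    have h73 : m₃ 7 0 = i := by rw [hA3' 7 (by simp), h72]
    have h23 : m₃ 2 = m 2 := by rw [hA3' 2 (by simp), h22]
    have h93 : m₃ 9 0 = scanDen (m 2) i := by rw [hA3' 9 (by simp), hA2' 9 (by simp), h91]
    have hD : |scanDen (m 2) (i + 1)| < 2 ^ L :=
      (abs_scanDen_le (m 1) (m 2) (i + 1)).trans_lt (hpow _ (hmono _ hi))
    refine .set_eq hB3 hs1 0 (scanDen (m 2) (i + 1)) rfl ?_ ?_
    · simp [Expr.eval, h73, h23, h93, scanDen, Finset.prod_range_succ]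
    · have hA30 : m₃.AgreeOff [7, 8, 9, 10] m :=
        (hA3'.trans (hA2'.trans hA1 (C := [7, 8, 9, 10]) (by simp) (by simp)) (by simp) (by simp))
      refine ⟨⟨hB3.put _ _ hD, hA30.put (by simp) _ _, ?_, by simp [Mem.put_apply]⟩,
        by simpa [Mem.put_apply] using h73⟩
      rw [Mem.put_of_ne _ _ _ (by simp), h83, ← pow_add]
      congr 1
      omega
  · rintro _ rfl
    refine ⟨hB9.put _ _ (by simp), (((Mem.AgreeOff.refl _ _).put (by simp) _ _).put
      (by simp) _ _).put (by simp) _ _, ?_, ?_⟩ <;> simp [Mem.put_apply, scanBits, scanDen]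

theorem Achieves.scaleProg {m : Mem} (hm : m.BoundedBy L) {n : ℕ} (hn : m 0 0 = n)
    (hnL : ((n * n : ℕ) : ℤ) < 2 ^ L)
    (hL : ∀ q < n * n, |m 1 q * (m 9 0 / m 2 q)| < 2 ^ L) :
    Achieves L (n * n + 1) scaleProg m fun m' => m'.BoundedBy L ∧ m'.AgreeOff [5, 7] m ∧
      ∀ q < n * n, m' 5 q = m 1 q * (m 9 0 / m 2 q) := by
  refine (Achieves.for (fun i m' => m'.BoundedBy L ∧ m'.AgreeOff [5, 7] m ∧
    ∀ q < i, m' 5 q = m 1 q * (m 9 0 / m 2 q)) le_rfl (n * n) hnL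
    ?_ ?_ ?_ hm ?_).mono (by omega) fun m' h => h
  · rintro i m' ⟨hB, hA, -⟩
    refine ⟨hB, ?_⟩
    have : m' 0 0 = n := by rw [hA 0 (by simp), hn]
    simp [Expr.eval, this]
  · rintro i m' v hv ⟨hB, hA, h5⟩
    exact ⟨hB.put _ _ hv, hA.put (by simp) _ _, by simpa [Mem.put_apply] using h5⟩
  · rintro i m' hi ⟨hB, hA, h5⟩ h7
    refine .set_eq hB le_rfl i _ (by simp [Expr.eval, h7]) rfl ?_
    have : Expr.eval m' (.mul (.get 1 (reg 7)) (.div (reg 9) (.get 2 (reg 7)))) =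
        m 1 i * (m 9 0 / m 2 i) := by
      simp [Expr.eval, h7, hA 1, hA 9, hA 2]
    rw [this]
    refine ⟨⟨hB.put _ _ (hL i hi), hA.put (by simp) _ _, fun q hq => ?_⟩,
      by simpa [Mem.put_apply] using h7⟩
    rw [Mem.put_apply]
    split_ifs with h
    · rw [h.2]
    · exact h5 q (by simp at h; omega)
  · rintro _ rfl
    exact ⟨hm.put _ _ (by simp), (Mem.AgreeOff.refl _ _).put (by simp) _ _, by simp⟩

end Scan

/-! ### Correctness of the elimination. -/

section Eliminate

variable {L n : ℕ}

theorem mul_add_div_of_lt {n i j : ℕ} (hj : j < n) : (i * n + j) / n = i := by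
  rw [Nat.add_comm, Nat.add_mul_div_right _ _ (by omega), Nat.div_eq_of_lt hj, zero_add]

theorem exists_fin_eq_mul_add {n q : ℕ} (hq : q < n * n) : ∃ i j : Fin n, q = i * n + j := by
  have hn : 0 < n := Nat.pos_of_mul_pos_left (Nat.zero_lt_of_lt hq)
  exact ⟨⟨q / n, Nat.div_lt_of_lt_mul hq⟩, ⟨q % n, Nat.mod_lt _ hn⟩, (Nat.div_add_mod' q n).symm⟩

theorem mul_add_inj {n : ℕ} {i j i' j' : Fin n} (h : (i * n + j : ℕ) = i' * n + j') :
    i = i' ∧ j = j' := by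
  have hi : (i : ℕ) = i' := by
    rw [← mul_add_div_of_lt (i := i) j.2, h, mul_add_div_of_lt j'.2]
  refine ⟨Fin.ext hi, Fin.ext ?_⟩
  rw [hi] at h
  omega

theorem mul_add_lt_mul (i j : Fin n) : (i * n + j : ℕ) < n * n := by
  have h1 := i.2
  have h2 := j.2
  calc (i * n + j : ℕ) < i * n + n := by omega
    _ = (i + 1) * n := by ring
    _ ≤ n * n := Nat.mul_le_mul_right _ h1

theorem eval_layer {m : Mem} {k a : ℕ} {e : Expr} (hn : m 0 0 = n) (hk : m 11 0 = k)
    (he : e.eval m = a) : (layer e).eval m = m 5 (k * (n * n) + a) := by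
  simp only [layer, Expr.eval, Int.toNat_zero, hn, hk, he]
  congr 1

theorem eval_pivot {m : Mem} {k : ℕ} (hn : m 0 0 = n) (hk : m 11 0 = k) :
    pivot.eval m = m 5 (k * (n * n) + (k * n + k)) :=
  eval_layer hn hk (by simp [Expr.eval, hn, hk])

/-- The new layer lies beyond all earlier ones, so the old entries stay readable during the step. -/
theorem Achieves.stepProg {m : Mem} (hm : m.BoundedBy L) (hn : m 0 0 = n)
    (hnL : ((n * n : ℕ) : ℤ) < 2 ^ L) (k : Fin n) (hk : m 11 0 = k) (w w' : Fin n → Fin n → ℤ)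
    (hw : ∀ i j : Fin n, m 5 (k * (n * n) + (i * n + j)) = w i j)
    (hw' : ∀ i j, m 3 k * ((w k k * w i j - w i k * w k j) / m 12 0) + (1 - m 3 k) * w i j = w' i j)
    (hL : ∀ i j, |w' i j| < 2 ^ L) :
    Achieves L (n * n + 1) stepProg m fun m' => m'.BoundedBy L ∧ m'.AgreeOff [5, 7] m ∧
      (∀ q < (k + 1) * (n * n), m' 5 q = m 5 q) ∧
      ∀ i j : Fin n, m' 5 ((k + 1) * (n * n) + (i * n + j)) = w' i j := by
  refine (Achieves.for (fun q m' => m'.BoundedBy L ∧ m'.AgreeOff [5, 7] m ∧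
      (∀ q < (k + 1) * (n * n), m' 5 q = m 5 q) ∧
      ∀ i j : Fin n, (i * n + j : ℕ) < q → m' 5 ((k + 1) * (n * n) + (i * n + j)) = w' i j)
      le_rfl (n * n) hnL ?_ ?_ ?_ hm ?_).mono (by omega)
      fun m' h => ⟨h.1, h.2.1, h.2.2.1, fun i j => h.2.2.2 i j (mul_add_lt_mul i j)⟩
  · rintro i m' ⟨hB, hA, -⟩
    refine ⟨hB, ?_⟩
    have : m' 0 0 = n := by rw [hA 0 (by simp), hn]
    simp [Expr.eval, this]
  · rintro i m' v hv ⟨hB, hA, h5, h5'⟩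
    exact ⟨hB.put _ _ hv, hA.put (by simp) _ _, by simpa [Mem.put_apply] using h5,
      by simpa [Mem.put_apply] using h5'⟩
  · rintro q m' hq ⟨hB, hA, h5, h5'⟩ h7
    obtain ⟨i, j, rfl⟩ := exists_fin_eq_mul_add hq
    have hn' : m' 0 0 = n := by rw [hA 0 (by simp), hn]
    have hk' : m' 11 0 = k := by rw [hA 11 (by simp), hk]
    have hw5 : ∀ i j : Fin n, m' 5 (k * (n * n) + (i * n + j)) = w i j := fun i j => by
      rw [h5 _ ?_, hw]
      have := mul_add_lt_mul i j
      rw [add_mul, one_mul]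
      omega
    have hdiv : ((i * n + j : ℕ) : ℤ) / n = i := by
      rw [← Int.natCast_div, mul_add_div_of_lt j.2]
    have e1 : (layer (reg 7)).eval m' = w i j := by
      rw [eval_layer hn' hk' (a := i * n + j) (by simpa [Expr.eval] using h7), hw5]
    have e2 : (layer (.add (.mul (.div (reg 7) (reg 0)) (reg 0)) (reg 11))).eval m' = w i k := by
      rw [eval_layer hn' hk' (a := i * n + k), hw5]
      simp only [Expr.eval, Int.toNat_zero, h7, hn', hk', hdiv]
      push_cast
      rfl
    have e3 : (layer (.add (.mul (reg 11) (reg 0))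
        (.sub (reg 7) (.mul (.div (reg 7) (reg 0)) (reg 0))))).eval m' = w k j := by
      rw [eval_layer hn' hk' (a := k * n + j), hw5]
      simp only [Expr.eval, Int.toNat_zero, h7, hn', hk', hdiv]
      push_cast
      ring
    have e4 : pivot.eval m' = w k k := by rw [eval_pivot hn' hk', hw5]
    have e5 : flag.eval m' = m 3 k := by simp [flag, Expr.eval, hk', hA 3]
    have e6 : (reg 12).eval m' = m 12 0 := by simp [Expr.eval, hA 12]
    refine .set_eq hB le_rfl ((k + 1) * (n * n) + (i * n + j)) (w' i j) ?_ ?_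
      ⟨⟨hB.put _ _ (hL i j), hA.put (by simp) _ _, fun q hq => ?_, fun i' j' hlt => ?_⟩, ?_⟩
    · simp [Expr.eval, h7, hn', hk']
    · simp only [Expr.eval] at e1 e2 e3 e4 e5 e6 ⊢
      rw [e1, e2, e3, e4, e5, e6, hw']
    · rw [Mem.put_apply, if_neg (by omega), h5 q hq]
    · rw [Mem.put_apply]
      split_ifs with h
      · obtain ⟨rfl, rfl⟩ := mul_add_inj (i := i) (j := j) (i' := i') (j' := j') (by omega)
        rfl
      · exact h5' i' j' (by omega)
    · simpa [Mem.put_apply] using h7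
  · rintro _ rfl
    exact ⟨hm.put _ _ (by simp), (Mem.AgreeOff.refl _ _).put (by simp) _ _,
      by simp [Mem.put_apply], by simp⟩

/-- The elements of `α` below `k`. -/
def below (α : Finset (Fin n)) (k : ℕ) : Finset (Fin n) := α.filter fun i => (i : ℕ) < k

theorem notMem_below (α : Finset (Fin n)) (k : Fin n) : k ∉ below α k := by simp [below]

theorem below_succ_of_mem {α : Finset (Fin n)} {k : Fin n} (hk : k ∈ α) :
    below α (k + 1) = insert k (below α k) := by
  ext i
  simp only [below, Finset.mem_filter, Finset.mem_insert, Fin.ext_iff]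
  constructor
  · rintro ⟨h, h'⟩
    rcases Nat.lt_succ_iff_lt_or_eq.1 h' with h' | h'
    exacts [Or.inr ⟨h, h'⟩, Or.inl h']
  · rintro (h | h)
    · exact ⟨Fin.ext h ▸ hk, by omega⟩
    · exact ⟨h.1, by omega⟩

theorem below_succ_of_notMem {α : Finset (Fin n)} {k : Fin n} (hk : k ∉ α) :
    below α (k + 1) = below α k := by
  ext i
  simp only [below, Finset.mem_filter]
  refine and_congr_right fun hi => ?_
  have : (i : ℕ) ≠ k := fun h => hk (Fin.ext h ▸ hi)
  omega

theorem below_zero (α : Finset (Fin n)) : below α 0 = ∅ := by simp [below]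

theorem below_self (α : Finset (Fin n)) : below α n = α := by simp [below]

/-- Invariant: layer `k` holds the minors bordering `below α k`, and the divisor is the minor of
`below α k`, which is positive. Positivity makes the next division exact and, by `hdet`, excludes `k
= n`. -/
theorem Achieves.elimProg {m : Mem} (hm : m.BoundedBy L) (hn : m 0 0 = n)
    (hnL : ((n * n : ℕ) : ℤ) < 2 ^ L) (hnL' : (n : ℤ) < 2 ^ L) (hL0 : 0 < L)
    (N : Matrix (Fin n) (Fin n) ℤ) (α : Finset (Fin n))
    (hα : ∀ i : Fin n, m 3 i = if i ∈ α then 1 else 0) (hN : ∀ i j : Fin n, m 5 (i * n + j) = N i j)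
    (hL : ∀ S i j, |borderedMinor N S i j| < 2 ^ L) (hdet : blockMinor N α ≤ 0) :
    Achieves L ((n + 1) * (n * n + 1)) elimProg m fun m' => m'.BoundedBy L ∧
      m'.AgreeOff [5, 7, 11, 12] m ∧ ∃ k : Fin n, m' 11 0 = k ∧ k ∈ α ∧
        0 < blockMinor N (below α k) ∧ blockMinor N (below α (k + 1)) ≤ 0 ∧
        m' 5 (k * (n * n) + (k * n + k)) = blockMinor N (below α (k + 1)) := by
  have hs1 : 1 ≤ n * n + 1 := Nat.succ_pos _
  have hs : 1 ≤ (n + 1) * (n * n + 1) := Nat.mul_pos n.succ_pos hs1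
  have h1L : |(1 : ℤ)| < 2 ^ L := by
    rw [abs_one]
    exact one_lt_pow₀ one_lt_two (by omega)
  have hB0 := hm.put 11 0 (v := 0) (by simp)
  have hB1 := hB0.put 12 0 h1L
  refine .seq hs (.set_eq hm hs 0 0 rfl rfl (.seq hs (.set_eq hB0 hs 0 1 rfl rfl ?_)))
  have hflag : ∀ (k : Fin n) (m' : Mem), m'.AgreeOff [5, 7, 11, 12] m → m' 11 0 = k →
      flag.eval m' = if k ∈ α then 1 else 0 := fun k m' hA hk => by
    simp [flag, Expr.eval, hk, hA 3, hα]
  refine (Achieves.loop (fun k m' => k ≤ n ∧ m'.BoundedBy L ∧ m'.AgreeOff [5, 7, 11, 12] m ∧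
    m' 11 0 = k ∧ m' 12 0 = blockMinor N (below α k) ∧ 0 < blockMinor N (below α k) ∧
    ∀ i j : Fin n, m' 5 (k * (n * n) + (i * n + j)) = borderedMinor N (below α k) i j) hs1
    (fun _ _ h => h.2.1) n ?_ ?_).mono le_rfl ?_
  · rintro k m₁ ⟨hkn, hB, hA, h11, h12, hpos, h5⟩ hcond
    have hlt : k < n := by
      refine lt_of_le_of_ne hkn fun h => ?_
      rw [h, below_self] at hpos
      omega
    refine ⟨hlt, ?_⟩
    obtain ⟨k, rfl⟩ : ∃ k' : Fin n, k = k' := ⟨⟨k, hlt⟩, rfl⟩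
    have hn1 : m₁ 0 0 = n := by rw [hA 0 (by simp), hn]
    have hf := hflag k m₁ hA h11
    have hf3 : m₁ 3 k = if k ∈ α then 1 else 0 := by rw [hA 3 (by simp), hα]
    have hp : pivot.eval m₁ = borderedMinor N (below α k) k k := by
      rw [eval_pivot hn1 h11, h5]
    simp only [Expr.eval] at hcond
    rw [hf, hp] at hcond
    refine .seq hs1 ((Achieves.stepProg hB hn1 hnL k h11 _
      (fun i j => borderedMinor N (below α (k + 1)) i j) h5 ?_ fun i j => hL _ _ _).mono le_rfl ?_)
    · intro i j
      rw [hf3, h12]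
      by_cases hk : k ∈ α
      · rw [if_pos hk, borderedMinor_insert_eq_ediv N (notMem_below α k) hpos.ne',
          below_succ_of_mem hk]
        ring
      · rw [if_neg hk, below_succ_of_notMem hk]
        ring
    rintro m₂ ⟨hB2, hA2, h52, h52'⟩
    have hA20 : m₂.AgreeOff [5, 7, 11, 12] m := hA2.trans hA (by simp) (by simp)
    have hn2 : m₂ 0 0 = n := by rw [hA20 0 (by simp), hn]
    have h112 : m₂ 11 0 = k := by rw [hA2 11 (by simp), h11]
    have h122 : m₂ 12 0 = blockMinor N (below α k) := by rw [hA2 12 (by simp), h12]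
    have hp2 : pivot.eval m₂ = borderedMinor N (below α k) k k := by
      rw [eval_pivot hn2 h112, h52, h5]
      have := mul_add_lt_mul k k
      rw [add_mul, one_mul]
      omega
    have hf2 := hflag k m₂ hA20 h112
    have hnext : Expr.eval m₂ (.add (.mul flag pivot) (.mul (.sub (.lit 1) flag) (reg 12))) =
        blockMinor N (below α (k + 1)) := by
      simp only [Expr.eval, Int.toNat_zero]
      rw [hf2, hp2, h122]
      by_cases hk : k ∈ α
      · rw [if_pos hk, below_succ_of_mem hk, blockMinor_insert N (notMem_below α k)]
        ring
      · rw [if_neg hk, below_succ_of_notMem hk]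
        ring
    have hbound : |blockMinor N (below α (k + 1))| < 2 ^ L := by
      by_cases hk : k ∈ α
      · rw [below_succ_of_mem hk, blockMinor_insert N (notMem_below α k)]
        exact hL _ _ _
      · rw [below_succ_of_notMem hk, ← h122]
        exact hB2 _ _
    have hB3 := hB2.put 12 0 hbound
    refine .seq hs1 (.set_eq hB2 hs1 0 _ rfl hnext (.set_eq hB3 hs1 0 (k + 1 : ℕ) rfl
      (by simp [Expr.eval, Mem.put_apply, h112])
      ⟨hlt, hB3.put _ _ ?_, (hA20.put (by simp) _ _).put (by simp) _ _, ?_, ?_, ?_, ?_⟩))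
    · rw [Nat.abs_cast]
      exact lt_of_le_of_lt (by exact_mod_cast hlt) hnL'
    · simp [Mem.put_apply]
    · simp [Mem.put_apply]
    · by_cases hk : k ∈ α
      · rw [below_succ_of_mem hk, blockMinor_insert N (notMem_below α k)]
        simpa [hk] using hcond
      · rwa [below_succ_of_notMem hk]
    · simpa [Mem.put_apply] using h52'
  · refine ⟨n.zero_le, hB1, ((Mem.AgreeOff.refl _ _).put (by simp) _ _).put (by simp) _ _,
      ?_, ?_, ?_, fun i j => ?_⟩
    · simp [Mem.put_apply]
    · simp [Mem.put_apply, below_zero, blockMinor_empty]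
    · simp [below_zero, blockMinor_empty]
    · simp [Mem.put_apply, below_zero, borderedMinor_empty, hN]
  · rintro m₁ ⟨k, -, ⟨hkn, hB, hA, h11, h12, hpos, h5⟩, hcond⟩
    have hlt : k < n := by
      refine lt_of_le_of_ne hkn fun h => ?_
      rw [h, below_self] at hpos
      omega
    obtain ⟨k, rfl⟩ : ∃ k' : Fin n, k = k' := ⟨⟨k, hlt⟩, rfl⟩
    have hn1 : m₁ 0 0 = n := by rw [hA 0 (by simp), hn]
    have hf := hflag k m₁ hA h11
    have hp : pivot.eval m₁ = borderedMinor N (below α k) k k := by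
      rw [eval_pivot hn1 h11, h5]
    simp only [Expr.eval] at hcond
    rw [hf, hp] at hcond
    -- Outside `α` the test has value 1, so the loop would not have stopped.
    have hk : k ∈ α := by
      by_contra hk
      simp [hk] at hcond
    refine ⟨hB, hA, k, h11, hk, hpos, ?_⟩
    rw [below_succ_of_mem hk, blockMinor_insert N (notMem_below α k), h5]
    exact ⟨by simpa [hk] using hcond, rfl⟩

end Eliminate

/-! ### Correctness of the output routine. -/

section Output

variable {L n : ℕ}

theorem Achieves.outputProg {m : Mem} (hm : m.BoundedBy L) (hn : m 0 0 = n)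
    (hnL' : (n : ℤ) < 2 ^ L) {σ k : ℕ} (hσ : 4 * σ * n < L) (hσ' : 4 * σ < L)
    (h8 : m 8 0 = 2 ^ σ) (hk : m 11 0 = k) :
    Achieves L (n + 1) outputProg m fun m' =>
      m' 0 0 = (if m 5 (k * (n * n) + (k * n + k)) < 0 then 1 else 0) ∧
      (∀ i < n, m' 1 i = if i < k + 1 then m 3 i else 0) ∧
      (∀ i < n, m' 2 i = if i < k then m 3 i else 0) ∧
      (∀ i < n, m' 3 i = 1) ∧ ∀ i < n, m' 4 i = 2 ^ (4 * (i + 1) * σ) := by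
  have hs : 1 ≤ n + 1 := n.succ_pos
  have h1L : |(1 : ℤ)| < 2 ^ L := by
    rw [abs_one]
    exact one_lt_pow₀ one_lt_two (by omega)
  have hpow : ∀ e < L, |(2 : ℤ) ^ e| < 2 ^ L := fun e he => by
    rw [abs_of_nonneg (by positivity)]
    exact pow_lt_pow_right₀ one_lt_two he
  have hB0 := hm.put 13 0 (hpow (4 * σ) hσ')
  have hB1 := hB0.put 14 0 h1L
  refine .seq hs (.set_eq hm hs 0 (2 ^ (4 * σ)) rfl (by simp [Expr.eval, h8]; ring)
    (.seq hs (.set_eq hB0 hs 0 1 rfl rfl (.seq hs ?_))))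
  refine (Achieves.for (fun q m' => m'.BoundedBy L ∧ m'.AgreeOff [1, 2, 3, 4, 7, 13, 14] m ∧
      m' 13 0 = 2 ^ (4 * σ) ∧ m' 14 0 = 2 ^ (4 * q * σ) ∧ (∀ i, q ≤ i → m' 3 i = m 3 i) ∧
      (∀ i < q, m' 1 i = if i < k + 1 then m 3 i else 0) ∧
      (∀ i < q, m' 2 i = if i < k then m 3 i else 0) ∧
      (∀ i < q, m' 3 i = 1) ∧ ∀ i < q, m' 4 i = 2 ^ (4 * (i + 1) * σ))
      le_rfl n hnL' ?_ ?_ ?_ hB1 ?_).mono (by omega) ?_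
  · rintro i m' ⟨hB, hA, -⟩
    exact ⟨hB, by simp [Expr.eval, hA 0, hn]⟩
  · rintro i m' v hv ⟨hB, hA, h13, h14, h3, h1, h2, h3', h4⟩
    refine ⟨hB.put _ _ hv, hA.put (by simp) _ _, ?_⟩
    simpa [Mem.put_apply, -Order.lt_add_one_iff] using ⟨h13, h14, h3, h1, h2, h3', h4⟩
  · rintro q m₁ hq ⟨hB, hA, h13, h14, h3, h1, h2, h3', h4⟩ h7
    have hb : |(2 : ℤ) ^ (4 * (q + 1) * σ)| < 2 ^ L := by
      refine hpow _ (lt_of_le_of_lt ?_ hσ)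
      calc 4 * (q + 1) * σ = 4 * σ * (q + 1) := by ring
        _ ≤ 4 * σ * n := Nat.mul_le_mul_left _ hq
    have h11 : m₁ 11 0 = k := by rw [hA 11 (by simp), hk]
    have hB2 := hB.put 14 0 hb
    have hB3 := hB2.put 4 q hb
    have h3q : m₁ 3 q = m 3 q := h3 q le_rfl
    have hv1 : |if q < k + 1 then m 3 q else 0| < 2 ^ L := by
      split_ifs
      exacts [hm _ _, by simp]
    have hv2 : |if q < k then m 3 q else 0| < 2 ^ L := by
      split_ifs
      exacts [hm _ _, by simp]
    have hB4 := hB3.put 1 q hv1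
    have hB5 := hB4.put 2 q hv2
    refine .seq le_rfl (.set_eq hB le_rfl 0 (2 ^ (4 * (q + 1) * σ)) rfl
      (by simp [Expr.eval, h13, h14]; ring) ?_)
    refine .seq le_rfl (.set_eq hB2 le_rfl q (2 ^ (4 * (q + 1) * σ))
      (by simp [Expr.eval, Mem.put_apply, h7]) (by simp [Expr.eval, Mem.put_apply]) ?_)
    -- The postcondition is split into its conjuncts for a variable memory with an equation, apart
    -- from the execution of the body.
    have key : ∀ m', m' = ((((m₁.put 14 0 (2 ^ (4 * (q + 1) * σ))).put 4 q
        (2 ^ (4 * (q + 1) * σ))).put 1 q (if q < k + 1 then m 3 q else 0)).put 2 q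
        (if q < k then m 3 q else 0)).put 3 q 1 → _ := fun m' h => (⟨⟨?_, ?_, ?_, ?_, ?_, ?_, ?_,
          ?_, ?_⟩, ?_⟩ : (m'.BoundedBy L ∧ m'.AgreeOff [1, 2, 3, 4, 7, 13, 14] m ∧
      m' 13 0 = 2 ^ (4 * σ) ∧ m' 14 0 = 2 ^ (4 * (q + 1) * σ) ∧ (∀ i, q + 1 ≤ i → m' 3 i = m 3 i) ∧
      (∀ i < q + 1, m' 1 i = if i < k + 1 then m 3 i else 0) ∧
      (∀ i < q + 1, m' 2 i = if i < k then m 3 i else 0) ∧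
      (∀ i < q + 1, m' 3 i = 1) ∧ ∀ i < q + 1, m' 4 i = 2 ^ (4 * (i + 1) * σ)) ∧ m' 7 0 = q)
    · refine .seq le_rfl (.ite_set hB3 le_rfl q (m 3 q) 0 (p := q < k + 1) ?_ ?_ ?_ rfl ?_)
      · simp only [Expr.eval, Mem.put_apply, Int.toNat_zero, h7, h11]
        simp
      · simp [Expr.eval, Mem.put_apply, h7]
      · simp [Expr.eval, Mem.put_apply, h7, h3q]
      refine .seq le_rfl (.ite_set hB4 le_rfl q (m 3 q) 0 (p := q < k) ?_ ?_ ?_ rfl ?_)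
      · simp [Expr.eval, Mem.put_apply, h7, h11]
      · simp [Expr.eval, Mem.put_apply, h7]
      · simp [Expr.eval, Mem.put_apply, h7, h3q]
      exact .set_eq hB5 le_rfl q 1 (by simp [Expr.eval, Mem.put_apply, h7]) rfl (key _ rfl)
    · exact h ▸ hB5.put 3 q h1L
    · exact h ▸ (((((hA.put (by simp) _ _).put (by simp) _ _).put (by simp) _ _).put
        (by simp) _ _).put (by simp) _ _)
    · simp [h, Mem.put_apply, h13]
    · simp [h, Mem.put_apply]
    · intro i hi
      have : i ≠ q := by omega
      simp [h, Mem.put_apply, this, h3 i (by omega)]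
    all_goals
      first
      | intro i hi
        rcases Nat.lt_succ_iff_lt_or_eq.1 hi with hi | rfl
        · simp [h, Mem.put_apply, hi.ne, h1 i, h2 i, h3' i, h4 i, hi]
        · simp [h, Mem.put_apply]
      | simpa [h, Mem.put_apply] using h7
  · rintro _ rfl
    refine ⟨hB1.put _ _ (by simp), (((Mem.AgreeOff.refl _ _).put (by simp) _ _).put
      (by simp) _ _).put (by simp) _ _, ?_⟩
    simp [Mem.put_apply]
  · rintro m₁ ⟨hB, hA, h13, h14, h3, h1, h2, h3', h4⟩
    have hp : pivot.eval m₁ = m 5 (k * (n * n) + (k * n + k)) := by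
      rw [eval_pivot (n := n) (k := k), hA 5 (by simp)]
      · rw [hA 0 (by simp), hn]
      · rw [hA 11 (by simp), hk]
    refine .ite hB hs (fun hc => ?_) (fun hc => ?_) <;> simp only [Expr.eval, hp] at hc
    · refine .set_eq hB hs 0 1 rfl rfl ?_
      rw [if_pos (by omega)]
      simpa [Mem.put_apply, -Order.lt_add_one_iff] using ⟨h1, h2, h3', h4⟩
    · refine .set_eq hB hs 0 0 rfl rfl ?_
      rw [if_neg (by omega)]
      simpa [Mem.put_apply, -Order.lt_add_one_iff] using ⟨h1, h2, h3', h4⟩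

end Output

/-! ### The encoded input in memory and its length. -/

section Input

theorem getD_ofFn {n : ℕ} (f : Fin n → ℤ) (i : Fin n) : (List.ofFn f).getD i 0 = f i := by
  simp

theorem bits_getD_le_sum (l : List ℤ) (j : ℕ) (hj : j < l.length) :
    bits (l.getD j 0) ≤ (l.map bits).sum := by
  rw [List.getD_eq_getElem _ _ hj]
  exact List.le_sum_of_mem (List.mem_map_of_mem (List.getElem_mem hj))

theorem boundedBy_load (x : List (List ℤ)) : (Mem.load x).BoundedBy (inputBits x) := by
  intro k j
  by_cases hk : k < x.length
  · by_cases hj : j < (x.getD k []).length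
    · refine (bits_le_iff _ _).1 (Nat.le_succ_of_le ((bits_getD_le_sum _ j hj).trans ?_))
      rw [List.getD_eq_getElem _ _ hk]
      exact List.le_sum_of_mem (List.mem_map_of_mem (f := fun l : List ℤ => (l.map bits).sum)
        (List.getElem_mem hk))
    · rw [Mem.load, List.getD_eq_default _ _ (not_lt.1 hj)]
      simp
  · rw [Mem.load, List.getD_eq_default _ _ (not_lt.1 hk)]
    simp

variable (x : MinorInstance)

theorem load_zero : Mem.load x.encode 0 0 = x.n := rfl

theorem divNat_mul_add {n : ℕ} (i j : Fin n) :
    (⟨i * n + j, mul_add_lt_mul i j⟩ : Fin (n * n)).divNat = i :=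
  Fin.ext (mul_add_div_of_lt j.2)

theorem modNat_mul_add {n : ℕ} (i j : Fin n) :
    (⟨i * n + j, mul_add_lt_mul i j⟩ : Fin (n * n)).modNat = j := by
  refine Fin.ext ?_
  simp [Fin.modNat, Nat.mod_eq_of_lt j.2]

theorem load_num (q : Fin (x.n * x.n)) :
    Mem.load x.encode 1 q = (x.M q.divNat q.modNat).num :=
  getD_ofFn (fun k : Fin (x.n * x.n) => (x.M k.divNat k.modNat).num) q

theorem load_den (q : Fin (x.n * x.n)) :
    Mem.load x.encode 2 q = (x.M q.divNat q.modNat).den :=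
  getD_ofFn (fun k : Fin (x.n * x.n) => ((x.M k.divNat k.modNat).den : ℤ)) q

theorem load_set (i : Fin x.n) : Mem.load x.encode 3 i = if i ∈ x.α then 1 else 0 :=
  getD_ofFn (fun i => if i ∈ x.α then 1 else 0) i

theorem load_num' (i j : Fin x.n) : Mem.load x.encode 1 (i * x.n + j) = (x.M i j).num := by
  have := load_num x ⟨i * x.n + j, mul_add_lt_mul i j⟩
  rwa [divNat_mul_add, modNat_mul_add] at this

theorem load_den' (i j : Fin x.n) : Mem.load x.encode 2 (i * x.n + j) = (x.M i j).den := by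
  have := load_den x ⟨i * x.n + j, mul_add_lt_mul i j⟩
  rwa [divNat_mul_add, modNat_mul_add] at this

theorem load_den_nonneg (q : ℕ) : 0 ≤ Mem.load x.encode 2 q := by
  by_cases hq : q < x.n * x.n
  · rw [load_den x ⟨q, hq⟩]
    exact Int.natCast_nonneg _
  · refine le_of_eq (List.getD_eq_default _ _ ?_).symm
    show (List.ofFn _).length ≤ q
    rw [List.length_ofFn]
    omega

theorem scanBits_load : scanBits (Mem.load x.encode 1) (Mem.load x.encode 2) (x.n * x.n) =
    matrixBits x.M := by
  rw [scanBits, Finset.sum_range]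
  simp_rw [load_num, load_den, Int.natAbs_natCast]
  rw [matrixBits, ← Finset.sum_product', Finset.univ_product_univ,
    ← Equiv.sum_comp finProdFinEquiv.symm]
  rfl

theorem inputBits_encode : inputBits x.encode = bits x.n +
    (∑ k : Fin (x.n * x.n), bits (x.M k.divNat k.modNat).num +
      (∑ k : Fin (x.n * x.n), bits ((x.M k.divNat k.modNat).den : ℤ) +
        ∑ i, bits (if i ∈ x.α then 1 else 0))) := by
  simp [inputBits, MinorInstance.encode, encodeSet, List.map_ofFn, List.sum_ofFn,
    Function.comp_def]

theorem matrixBits_le_inputBits : matrixBits x.M ≤ inputBits x.encode := by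
  have : matrixBits x.M ≤ ∑ k : Fin (x.n * x.n), bits (x.M k.divNat k.modNat).num +
      ∑ k : Fin (x.n * x.n), bits ((x.M k.divNat k.modNat).den : ℤ) := by
    rw [← scanBits_load, scanBits, Finset.sum_range, ← Finset.sum_add_distrib]
    refine Finset.sum_le_sum fun q _ => ?_
    rw [load_num, load_den, bits, bits]
    omega
  rw [inputBits_encode]
  omega

/-- Every numerator takes at least one bit. So loops of length n² are affordable although n is
written in binary. -/
theorem mul_self_le_inputBits : x.n * x.n ≤ inputBits x.encode := by
  have : ∑ _k : Fin (x.n * x.n), 1 ≤ ∑ k : Fin (x.n * x.n), bits (x.M k.divNat k.modNat).num :=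
    Finset.sum_le_sum fun _ _ => one_le_bits _
  rw [Fin.sum_const, smul_eq_mul, mul_one] at this
  rw [inputBits_encode]
  omega

end Input

/-! ### Assembly of the algorithm. -/

section Solve

variable (x : MinorInstance)

/-- The product of all denominators. -/
def commonDen : ℤ := scanDen (Mem.load x.encode 2) (x.n * x.n)

/-- The matrix multiplied by the product of all denominators. -/
def scaledMatrix : Matrix (Fin x.n) (Fin x.n) ℤ :=
  Matrix.of fun i j => (x.M i j).num * (commonDen x / (x.M i j).den)

theorem commonDen_pos : 0 < commonDen x := by
  rw [commonDen, scanDen]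
  refine Finset.prod_pos fun q hq => ?_
  rw [load_den x ⟨q, Finset.mem_range.1 hq⟩]
  exact_mod_cast Rat.den_pos _

theorem commonDen_le : commonDen x ≤ 2 ^ matrixBits x.M := by
  rw [← scanBits_load]
  exact (le_abs_self _).trans (abs_scanDen_le _ _ _)

theorem cast_scaledMatrix (i j : Fin x.n) :
    ((scaledMatrix x i j : ℤ) : ℚ) = commonDen x * x.M i j := by
  have hdvd : ((x.M i j).den : ℤ) ∣ commonDen x := by
    rw [← load_den']
    exact Finset.dvd_prod_of_mem _ (Finset.mem_range.2 (mul_add_lt_mul i j))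
  have hne : ((x.M i j).den : ℚ) ≠ 0 := by exact_mod_cast Rat.den_nz _
  rw [scaledMatrix, Matrix.of_apply, Int.cast_mul, Int.cast_div hdvd (by exact_mod_cast hne)]
  conv_rhs => rw [← Rat.num_div_den (x.M i j)]
  push_cast
  ring

theorem abs_scaledMatrix_le (i j : Fin x.n) :
    |scaledMatrix x i j| ≤ 2 ^ (2 * inputBits x.encode) := by
  have h1 : |(x.M i j).num| < 2 ^ inputBits x.encode := by
    rw [← load_num']
    exact boundedBy_load _ _ _
  have h2 : commonDen x / (x.M i j).den ≤ 2 ^ inputBits x.encode :=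
    (Int.ediv_le_self _ (commonDen_pos x).le).trans ((commonDen_le x).trans
      (pow_le_pow_right₀ one_le_two (matrixBits_le_inputBits x)))
  have h3 : 0 ≤ commonDen x / (x.M i j).den :=
    Int.ediv_nonneg (commonDen_pos x).le (Int.natCast_nonneg _)
  rw [scaledMatrix, Matrix.of_apply, abs_mul, abs_of_nonneg h3, two_mul, pow_add]
  exact mul_le_mul h1.le h2 h3 (by positivity)

theorem cast_blockMinor_scaledMatrix (S : Finset (Fin x.n)) :
    ((blockMinor (scaledMatrix x) S : ℤ) : ℚ) = (commonDen x : ℚ) ^ S.card * principalMinor x.M S :=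
  cast_blockMinor_smul _ _ _ (cast_scaledMatrix x) S

theorem commonDen_pow_pos (c : ℕ) : 0 < (commonDen x : ℚ) ^ c :=
  pow_pos (by exact_mod_cast commonDen_pos x) _

theorem blockMinor_scaledMatrix_pos_iff (S : Finset (Fin x.n)) :
    0 < blockMinor (scaledMatrix x) S ↔ 0 < principalMinor x.M S := by
  rw [← mul_pos_iff_of_pos_left (commonDen_pow_pos x S.card), ← cast_blockMinor_scaledMatrix]
  exact_mod_cast Iff.rfl

theorem blockMinor_scaledMatrix_neg_iff (S : Finset (Fin x.n)) :
    blockMinor (scaledMatrix x) S < 0 ↔ principalMinor x.M S < 0 := by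
  have h : principalMinor x.M S < 0 ↔ (commonDen x : ℚ) ^ S.card * principalMinor x.M S < 0 := by
    simp [mul_neg_iff, commonDen_pow_pos x S.card, (commonDen_pow_pos x S.card).le]
  rw [h, ← cast_blockMinor_scaledMatrix]
  exact_mod_cast Iff.rfl

theorem powerVector_eq_inv (n σ : ℕ) (i : Fin n) :
    powerVector n σ i = (((2 ^ (4 * ((i : ℕ) + 1) * σ) : ℕ) : ℚ))⁻¹ := by
  simp [powerVector]

theorem num_powerVector (n σ : ℕ) (i : Fin n) : (powerVector n σ i).num = 1 := by
  rw [powerVector_eq_inv]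
  exact Rat.inv_natCast_num_of_pos (by positivity)

theorem den_powerVector (n σ : ℕ) (i : Fin n) :
    (powerVector n σ i).den = 2 ^ (4 * ((i : ℕ) + 1) * σ) := by
  rw [powerVector_eq_inv]
  exact Rat.inv_natCast_den_of_pos (by positivity)

theorem below_subset {n : ℕ} (α : Finset (Fin n)) (k : ℕ) : below α k ⊆ α :=
  Finset.filter_subset _ _

theorem ite_lt_eq_ite_mem_below {n : ℕ} (α : Finset (Fin n)) (k : ℕ) (i : Fin n) :
    (if (i : ℕ) < k then (if i ∈ α then (1 : ℤ) else 0) else 0) =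
      if i ∈ below α k then 1 else 0 := by
  by_cases h : (i : ℕ) < k <;> simp [below, h]

theorem holds_ofFn {m : Mem} {n k : ℕ} {f : Fin n → ℤ} (h : ∀ i : Fin n, m k i = f i) (j : ℕ)
    (hj : j < (List.ofFn f).length) : m k j = (List.ofFn f).getD j 0 := by
  rw [List.length_ofFn] at hj
  rw [getD_ofFn f ⟨j, hj⟩]
  exact h ⟨j, hj⟩

/-- As n, σ ≤ b, the word length 5(b + 1)² exceeds the lengths 2b of scaled entries, (n + 1)(n + 1 +
2b) of bordered minors and 4σn of the output. As n² ≤ b, the pass counts (n² + 1)(b + 1) and (n +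
1)(n² + 1) are at most (b + 1)². -/
theorem achieves_solver (hx : principalMinor x.M x.α ≤ 0) (b L : ℕ) (hb : b = inputBits x.encode)
    (hLb : L = 5 * (b + 1) ^ 2) :
    Achieves L ((b + 1) ^ 2) solver (Mem.load x.encode) fun m => ∃ k : Fin x.n, k ∈ x.α ∧
      0 < principalMinor x.M (below x.α k) ∧ principalMinor x.M (below x.α (k + 1)) ≤ 0 ∧
      m 0 0 = (if principalMinor x.M (below x.α (k + 1)) < 0 then 1 else 0) ∧
      (∀ i : Fin x.n, m 1 i = if i ∈ below x.α (k + 1) then 1 else 0) ∧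
      (∀ i : Fin x.n, m 2 i = if i ∈ below x.α k then 1 else 0) ∧
      (∀ i : Fin x.n, m 3 i = 1) ∧
      ∀ i : Fin x.n, m 4 i = 2 ^ (4 * ((i : ℕ) + 1) * matrixBits x.M) := by
  set n := x.n with hn
  set σ := matrixBits x.M with hσ
  have hnn : n * n ≤ b := hb ▸ mul_self_le_inputBits x
  have hnb : n ≤ b := (Nat.le_mul_self n).trans hnn
  have hσb : σ ≤ b := hb ▸ matrixBits_le_inputBits x
  have hbL : b < L := by rw [hLb]; nlinarith
  have hbpow : ∀ a : ℕ, a ≤ b → (a : ℤ) < 2 ^ L := fun a ha => by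
    have : a < 2 ^ L := (ha.trans hbL.le).trans_lt Nat.lt_two_pow_self
    exact_mod_cast this
  have hnL := hbpow _ hnn
  have hnL' := hbpow _ hnb
  have hs : 1 ≤ (b + 1) ^ 2 := Nat.pos_of_ne_zero (by positivity)
  have hB : (Mem.load x.encode).BoundedBy L := fun k j =>
    (boundedBy_load _ k j).trans (pow_lt_pow_right₀ one_lt_two (hb ▸ hbL))
  refine .seq hs ((Achieves.scanProg hB (load_zero x) hnL (load_den_nonneg x)
    (by rwa [scanBits_load]) hbL).mono (by rw [pow_two]; gcongr) ?_)
  rintro m₁ ⟨hB1, hA1, h18, h19⟩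
  rw [scanBits_load] at h18
  have hentry : ∀ i j : Fin n, m₁ 1 (i * n + j) * (m₁ 9 0 / m₁ 2 (i * n + j)) =
      scaledMatrix x i j := fun i j => by
    rw [hA1 1 (by simp), hA1 2 (by simp), h19, load_num', load_den']
    rfl
  have hLN : ∀ i j : Fin n, |scaledMatrix x i j| < 2 ^ L := fun i j =>
    (abs_scaledMatrix_le x i j).trans_lt (pow_lt_pow_right₀ one_lt_two (by
      rw [← hb, hLb]; nlinarith))
  refine .seq hs ((Achieves.scaleProg hB1 (by rw [hA1 0 (by simp), load_zero]) hnL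
    (fun q hq => ?_)).mono (by nlinarith) ?_)
  · obtain ⟨i, j, rfl⟩ := exists_fin_eq_mul_add hq
    rw [hentry]
    exact hLN i j
  rintro m₂ ⟨hB2, hA2, h25⟩
  have hA20 : m₂.AgreeOff [5, 7, 8, 9, 10] (Mem.load x.encode) := hA2.trans hA1 (by simp) (by simp)
  refine .seq hs ((Achieves.elimProg hB2 (by rw [hA20 0 (by simp), load_zero]) hnL hnL'
    (by omega) (scaledMatrix x) x.α (fun i => by rw [hA20 3 (by simp), load_set])
    (fun i j => by rw [h25 _ (mul_add_lt_mul i j), hentry]) (fun S i j => ?_)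
    (not_lt.1 fun h => hx.not_gt ((blockMinor_scaledMatrix_pos_iff x _).1 h))).mono ?_ ?_)
  · refine (abs_borderedMinor_le _ S i j _ (abs_scaledMatrix_le x)).trans_lt
      (pow_lt_pow_right₀ one_lt_two ?_)
    rw [← hb, hLb]
    calc (n + 1) * (n + 1 + 2 * b) ≤ (b + 1) * (b + 1 + 2 * b) := by gcongr
      _ < _ := by nlinarith
  · rw [pow_two]
    gcongr
  rintro m₃ ⟨hB3, hA3, k, h311, hkα, hpos, hle, h35⟩
  have hA30 : m₃.AgreeOff [5, 7, 8, 9, 10, 11, 12] (Mem.load x.encode) :=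
    hA3.trans hA20 (by simp) (by simp)
  refine (Achieves.outputProg hB3 (by rw [hA30 0 (by simp), load_zero]) hnL' (σ := σ) (k := k)
    ?_ ?_ (by rw [hA3 8 (by simp), hA2 8 (by simp), h18]) h311).mono (by nlinarith) ?_
  · calc 4 * σ * n ≤ 4 * b * b := by gcongr
      _ < L := by rw [hLb]; nlinarith
  · rw [hLb]; nlinarith
  rintro m₄ ⟨h40, h41, h42, h43, h44⟩
  refine ⟨k, hkα, (blockMinor_scaledMatrix_pos_iff x _).1 hpos,
    not_lt.1 fun h => hle.not_gt ((blockMinor_scaledMatrix_pos_iff x _).2 h), ?_, fun i => ?_,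
    fun i => ?_, fun i => h43 i i.2, fun i => h44 i i.2⟩
  · rw [h40, h35]
    simp only [blockMinor_scaledMatrix_neg_iff]
  · rw [h41 i i.2, hA30 3 (by simp), load_set, ite_lt_eq_ite_mem_below]
  · rw [h42 i i.2, hA30 3 (by simp), load_set, ite_lt_eq_ite_mem_below]

/-- Array 1 serves both cases: it is the singular set for tag 0, and the larger set of the pair for
tag 1. -/
theorem exists_witness_of_output {m : Mem} {k : Fin x.n} (hk : k ∈ x.α)
    (hpos : 0 < principalMinor x.M (below x.α k))
    (hle : principalMinor x.M (below x.α (k + 1)) ≤ 0)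
    (h0 : m 0 0 = if principalMinor x.M (below x.α (k + 1)) < 0 then 1 else 0)
    (h1 : ∀ i : Fin x.n, m 1 i = if i ∈ below x.α (k + 1) then 1 else 0)
    (h2 : ∀ i : Fin x.n, m 2 i = if i ∈ below x.α k then 1 else 0)
    (h3 : ∀ i : Fin x.n, m 3 i = 1)
    (h4 : ∀ i : Fin x.n, m 4 i = 2 ^ (4 * ((i : ℕ) + 1) * matrixBits x.M)) :
    ∃ w : USOWitness x.n, m.Holds w.encode ∧ w.IsViolation x.M ∧ w.Prescribed x.M x.α := by
  rcases hle.eq_or_lt with hzero | hneg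
  · refine ⟨.singular (below x.α (k + 1)), ?_, ?_, below_subset _ _, hzero⟩
    · rw [if_neg hzero.not_lt] at h0
      intro a ha j hj
      simp only [USOWitness.encode, List.length_cons, List.length_nil] at ha
      interval_cases a
      · obtain rfl : j = 0 := by simpa [USOWitness.encode] using hj
        exact h0
      · exact holds_ofFn h1 j hj
    · show ¬ IsUnit _
      simp [isUnit_cone_iff, hzero]
  · have hmem : k ∈ below x.α (k + 1) := by simp [below, hk]
    have herase : below x.α k = (below x.α (k + 1)).erase k := by
      rw [below_succ_of_mem hk, Finset.erase_insert (notMem_below _ _)]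
    refine ⟨.pair (powerVector x.n (matrixBits x.M)) (below x.α (k + 1)) (below x.α k), ?_, ?_,
      below_subset _ _, ⟨k, hmem, herase⟩, hneg, hpos, rfl,
      nondegenerate_powerVector _ _ le_rfl⟩
    · rw [if_pos hneg] at h0
      intro a ha j hj
      simp only [USOWitness.encode, List.length_cons, List.length_nil] at ha
      interval_cases a
      · obtain rfl : j = 0 := by simpa [USOWitness.encode] using hj
        exact h0
      · exact holds_ofFn h1 j hj
      · exact holds_ofFn h2 j hj
      · exact holds_ofFn (fun i => by rw [h3, num_powerVector]) j hj
      · exact holds_ofFn (fun i => by rw [h4, den_powerVector]; push_cast; rfl) j hj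
    · show FailedUSO _ _ _ _
      rw [herase] at hpos ⊢
      exact failedUSO_erase _ _ hmem hneg hpos _

theorem solvableInPolyTime : SolvableInPolyTime (Y := fun x : MinorInstance => USOWitness x.n)
    MinorInstance.encode (fun _ w => w.encode) (fun x => principalMinor x.M x.α ≤ 0)
    (fun x w => w.IsViolation x.M ∧ w.Prescribed x.M x.α) := by
  -- Weight times passes times L + 1, as a polynomial in the input length.
  refine ⟨solver, Polynomial.C solver.weight * (Polynomial.X + 1) ^ 2 *
    (5 * (Polynomial.X + 1) ^ 2 + 1), fun x hx => ?_⟩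
  obtain ⟨m, t, hr, ht, k, hk, hpos, hle, h0, h1, h2, h3, h4⟩ := achieves_solver x hx _ _ rfl rfl
  obtain ⟨w, hw, hw'⟩ := exists_witness_of_output x hk hpos hle h0 h1 h2 h3 h4
  exact ⟨w, m, t, hr, by simpa using ht, hw, hw'⟩

end Solve

end PMatrixUSO

theorem mainTheorem4 :
    -- a nonpositive principal minor yields a singular one or a sign change
    (∀ (n : ℕ) (M : Matrix (Fin n) (Fin n) ℝ) (α₀ : Finset (Fin n)), principalMinor M α₀ ≤ 0 →
      ∃ α ⊆ α₀, (principalMinor M α = 0 ∧ ¬ IsUnit (cone M α)) ∨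
        ∃ i ∈ α, principalMinor M α < 0 ∧ 0 < principalMinor M (α.erase i)) ∧
    -- a sign change and any nondegenerate vector yield a failed unique sink orientation
    (∀ (n : ℕ) (M : Matrix (Fin n) (Fin n) ℝ) (α : Finset (Fin n)), ∀ i ∈ α,
      principalMinor M α < 0 → 0 < principalMinor M (α.erase i) →
      ∀ q : Fin n → ℝ, Nondegenerate M q →
        outmap M q α i = outmap M q (α.erase i) i ∧ FailedUSO M q α (α.erase i)) ∧
    -- an explicit nondegenerate vector
    (∀ (n : ℕ) (M : Matrix (Fin n) (Fin n) ℚ) (σ : ℕ), matrixBits M ≤ σ →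
      Nondegenerate M (powerVector n σ)) ∧
    -- the conversion in polynomial time
    SolvableInPolyTime (Y := fun x : MinorInstance => USOWitness x.n)
      MinorInstance.encode (fun _ w => w.encode)
      (fun x => principalMinor x.M x.α ≤ 0)
      (fun x w => w.IsViolation x.M ∧ w.Prescribed x.M x.α) :=
  ⟨fun _ M α₀ h => exists_singular_or_sign_change M α₀ h,
    fun _ M α _ hi hα hβ q _ =>
      ⟨outmap_eq_outmap_erase M α hi hα hβ q, failedUSO_erase M α hi hα hβ q⟩,
    fun _ M σ hσ => nondegenerate_powerVector M σ hσ, solvableInPolyTime⟩
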